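/- \textbf{Setting.} Let $\overline{\mathbb R}=\mathbb R\cup\{\infty\}$, $n=n_1+\dots+n_N$, and write $x=(x_1,\dots,x_N)\in\mathbb R^n=\mathbb R^{n_1}\times\dots\times\mathbb R^{n_N}$. For $z\in\mathbb R^{n_i}$ let $x+U_i(z-x_i)$ denote $x$ with its $i$-th block replaced by $z$, and for $F:\mathbb R^n\to\overline{\mathbb R}$ put $F^i_x(z)=F(x+U_i(z-x_i))$. A function is proper if it never equals $-\infty$ and is not identically $\infty$; $\operatorname{dom}F=\{F<\infty\}$; $\nabla_i$ is the gradient in the $i$-th block; $\partial$ is the limiting (Mordukhovich) subdifferential, and $x$ is a critical (stationary) point of $F$ if $0\in\partial F(x)$. Let $\varphi(x)=f(x)+\sum_{i=1}^N g_i(x_i)$, and assume: (a) each $g_i:\mathbb R^{n_i}\to\overline{\mathbb R}$ is proper and lower semicontinuous (lsc); (b) $h:\mathbb R^n\to\overline{\mathbb R}$ is proper and lsc, $\operatorname{int}\operatorname{dom}h\ne\emptyset$, and $h$ is $C^1$ on $\operatorname{int}\operatorname{dom}h$; for all $x\in\operatorname{dom}h$ and all $i$, $h^i_x$ is strictly convex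 and $h_x^i(z)/\|z\|\to\infty$ as $\|z\|\to\infty$; and $h$ is multi-block essentially smooth: $\|\nabla_ih(x^k)\|\to\infty$ for every $i$ whenever $(x^k)\subset\operatorname{int}\operatorname{dom}h$ converges to a boundary point of $\operatorname{dom}h$; (c) $f:\mathbb R^n\to\overline{\mathbb R}$ is proper and lsc, finite and $C^1$ on $\operatorname{int}\operatorname{dom}h$, and $(L_1,\dots,L_N)$-smooth relative to $h$ with $L_i\ge0$: for all $x\in\operatorname{dom}h$ and all $i$, the function $L_ih^i_x-f^i_x$ (taken to be $\infty$ where $h_x^i=\infty$) has values in $\overline{\mathbb R}$ and is convex (in particular $f<\infty$ on $\operatorname{dom}h$); (d) $\varphi$ has a minimizer (with finite value), and $\operatorname{dom}\varphi\subseteq\operatorname{int}\operatorname{dom}h$; (e) $\nabla f$ and $\nabla h$ are locally Lipschitz on $\operatorname{int}\operatorname{dom}h$. For $x\in\operatorname{int}\operatorname{dom}h$ let $D_h(y,x)=h(y)-h(x)-\langle\nabla h(x),y-x\rangle$, and $D_h(y,x)=\infty$ otherwise. For $\gamma>0$ let \[T^i_{\gamma}(x)=\operatorname*{argmin}_{z\in\mathbb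 R^{n_i}}\Big\{\langle\nabla_if(x),z-x_i\rangle+\tfrac1\gamma D_h(x+U_i(z-x_i),x)+g_i(z)\Big\},\] where the argmin of a function identically $\infty$ is empty. For a sequence $(x^k)_{k\ge0}$ put $x^{k,i}=(x_1^{k+1},\dots,x_i^{k+1},x_{i+1}^k,\dots,x_N^k)$. \emph{BPALM}: given $\gamma_i\in(0,1/L_i)$ (with $1/0=\infty$), the sequence satisfies $x_i^{k+1}\in T^i_{\gamma_i}(x^{k,i-1})$ for all $k\ge0$ and $i=1,\dots,N$. \emph{A-BPALM}: given $\nu>1$, $0<\overline L_i^0\le L_i$ and $\gamma_i^0\in(0,1/\overline L_i^0)$, at cycle $k$ and block $i$ one tries $p=0,1,2,\dots$ successively, choosing in trial $p$ a point $z\in T^i_{\gamma_i^k/\nu^p}(x^{k,i-1})$, until, with $y=x^{k,i-1}+U_i(z-x_i^k)$, \[f(y)\le f(x^{k,i-1})+\langle\nabla_if(x^{k,i-1}),z-x_i^k\rangle+\nu^p\,\overline L_i^k\,D_h(y,x^{k,i-1});\] for the first trial $p$ that passes one sets $x_i^{k+1}=z$, $\overline L_i^{k+1}=\nu^p\overline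 L_i^k$, $\gamma_i^{k+1}=\gamma_i^k/\nu^p$. A proper lsc function $F:\mathbb R^n\to\overline{\mathbb R}$ has the Kurdyka--{\L}ojasiewicz (KL) property at $\bar x\in\operatorname{dom}F$ if there are $\eta,\varepsilon>0$ and a concave $\psi:[0,\eta]\to[0,\infty)$ with $\psi(0)=0$, $\psi\in C^1(0,\eta)$ and $\psi>0$ on $(0,\eta)$, such that $\psi'(F(x)-F(\bar x))\operatorname{dist}(0,\partial F(x))\ge1$ whenever $\|x-\bar x\|<\varepsilon$ and $F(\bar x)<F(x)<F(\bar x)+\eta$ (with $\operatorname{dist}(0,\emptyset)=\infty$). $F$ is a KL function if this holds at every point of $\operatorname{dom}\partial F=\{x:\partial F(x)\ne\emptyset\}$. \textbf{Theorem (global convergence).} Assume (a)--(e). Let $h$ be multi-block globally strongly convex with moduli $\sigma_1,\dots,\sigma_N>0$, i.e. $h_x^i$ is $\sigma_i$-strongly convex for all $x\in\operatorname{dom}h$ and all $i$, and let $\varphi$ be a KL function. Let $(x^k)$ be a bounded sequence generated by BPALM. Then 1. $(x^k)$ has finite length: $\sum_{k}\|x_i^{k+1}-x_i^k\|<\infty$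 for $i=1,\dots,N$; 2. $(x^k)$ converges to a critical point $x^\star$ of $\varphi$. The same two conclusions hold for every bounded sequence $(x^k)$ generated by A-BPALM. -/

import Mathlib

open Filter Topology

noncomputable section

namespace BPALM

/-- The `i`-th block space `ℝ^{n_i}`. -/
abbrev Block {N : ℕ} (n : Fin N → ℕ) (i : Fin N) : Type := EuclideanSpace ℝ (Fin (n i))

/-- The full space `ℝ^{n_1} × ⋯ × ℝ^{n_N} = ℝ^{n_1 + ⋯ + n_N}` with its Euclidean structure. -/
abbrev Space {N : ℕ} (n : Fin N → ℕ) : Type := PiLp 2 (fun i : Fin N => Block n i)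

section General

variable {E : Type*}

/-- The effective domain of an extended-real-valued function. -/
def effDom (F : E → EReal) : Set E := {x | F x < ⊤}

/-- `F` never takes the value `-∞` and is not identically `+∞`. -/
def Proper (F : E → EReal) : Prop := (∀ x, F x ≠ ⊥) ∧ ∃ x, F x ≠ ⊤

/-- The set of minimizers; it is empty if `F` is identically `+∞`. -/
def argmin (F : E → EReal) : Set E := {x | F x < ⊤ ∧ ∀ y, F x ≤ F y}

variable [NormedAddCommGroup E] [InnerProductSpace ℝ E]

/-- The gradient of an extended-real-valued function, meaningful where the function is finite
in a neighbourhood and differentiable. -/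
def grad [CompleteSpace E] (F : E → EReal) (x : E) : E := gradient (fun y => (F y).toReal) x

/-- Strict convexity of a function with values in `(-∞, ∞]`. -/
def IsStrictlyConvex (F : E → EReal) : Prop :=
  StrictConvexOn ℝ (effDom F) (fun z => (F z).toReal)

/-- Strong convexity, with modulus `σ`, of a function with values in `(-∞, ∞]`. -/
def IsStronglyConvex (σ : ℝ) (F : E → EReal) : Prop :=
  StrongConvexOn (effDom F) σ (fun z => (F z).toReal)

/-- `F(z) / ‖z‖ → ∞` as `‖z‖ → ∞`. -/
def OneCoercive (F : E → EReal) : Prop :=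
  Tendsto (fun z => F z / ((‖z‖ : ℝ) : EReal)) (Bornology.cobounded E) (𝓝 ⊤)

/-- Regular (Fréchet) subgradients: `F(z) ≥ F(x) + ⟨v, z - x⟩ + o(‖z - x‖)`, at points of
finiteness of `F`. -/
def regSubdiff (F : E → EReal) (x : E) : Set E :=
  {v | F x < ⊤ ∧ ∀ ε : ℝ, 0 < ε → ∀ᶠ z in 𝓝 x,
    F x + ((inner ℝ v (z - x) - ε * ‖z - x‖ : ℝ) : EReal) ≤ F z}

/-- The limiting (Mordukhovich) subdifferential, at points of finiteness of `F`. -/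
def subdiff (F : E → EReal) (x : E) : Set E :=
  {v | F x < ⊤ ∧ ∃ (u w : ℕ → E), Tendsto u atTop (𝓝 x) ∧
    Tendsto (fun k => F (u k)) atTop (𝓝 (F x)) ∧
    (∀ k, w k ∈ regSubdiff F (u k)) ∧ Tendsto w atTop (𝓝 v)}

/-- Critical (stationary) points. -/
def crit (F : E → EReal) : Set E := {x | (0 : E) ∈ subdiff F x}

/-- The Kurdyka–Łojasiewicz property of `F` at `xs`, with a desingularizing function `ψ` that is
concave on `[0, η]` and continuously differentiable on `(0, η)`.
The distance to the empty set is `∞`. -/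
def KLAt (F : E → EReal) (xs : E) : Prop :=
  ∃ (η ε : ℝ) (ψ : ℝ → ℝ), 0 < η ∧ 0 < ε ∧
    ConcaveOn ℝ (Set.Icc 0 η) ψ ∧ (∀ s ∈ Set.Icc 0 η, 0 ≤ ψ s) ∧ ψ 0 = 0 ∧
    ContDiffOn ℝ 1 ψ (Set.Ioo 0 η) ∧ (∀ s ∈ Set.Ioo 0 η, 0 < ψ s) ∧
    ∀ x ∈ Metric.ball xs ε, F xs < F x → F x < F xs + (η : EReal) →
      1 ≤ ENNReal.ofReal (deriv ψ ((F x).toReal - (F xs).toReal)) *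
        Metric.infEDist 0 (subdiff F x)

/-- A KL function: the KL property holds at every point of the domain of the subdifferential. -/
def IsKL (F : E → EReal) : Prop := ∀ x, (subdiff F x).Nonempty → KLAt F x

end General

variable {N : ℕ} {n : Fin N → ℕ}

/-- `x + U_i (z - x_i)`: the `i`-th block of `x` is replaced by `z`. -/
def blockMove (x : Space n) (i : Fin N) (z : Block n i) : Space n :=
  WithLp.toLp 2 (Function.update (WithLp.ofLp x) i z)

/-- The block restriction `F_x^i(z) = F(x + U_i (z - x_i))`. -/
def slice (F : Space n → EReal) (x : Space n) (i : Fin N) : Block n i → EReal :=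
  fun z => F (blockMove x i z)

/-- All block restrictions of `h` are strictly convex. -/
def MultiBlockStrictlyConvex (h : Space n → EReal) : Prop :=
  ∀ x ∈ effDom h, ∀ i, IsStrictlyConvex (slice h x i)

/-- Multi-block (global) strong convexity with moduli `σ_1, …, σ_N > 0`. -/
def MultiBlockStronglyConvex (σ : Fin N → ℝ) (h : Space n → EReal) : Prop :=
  (∀ i, 0 < σ i) ∧ ∀ x ∈ effDom h, ∀ i, IsStronglyConvex (σ i) (slice h x i)

/-- All block restrictions of `h` are `1`-coercive. -/
def MultiBlockOneCoercive (h : Space n → EReal) : Prop :=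
  ∀ x ∈ effDom h, ∀ i, OneCoercive (slice h x i)

/-- Every partial gradient blows up along interior sequences converging to the boundary. -/
def MultiBlockEssentiallySmooth (h : Space n → EReal) : Prop :=
  ∀ (u : ℕ → Space n) (b : Space n), (∀ k, u k ∈ interior (effDom h)) →
    b ∈ frontier (effDom h) → Tendsto u atTop (𝓝 b) →
    ∀ i, Tendsto (fun k => ‖grad h (u k) i‖) atTop atTop

/-- `F` is finite and continuously differentiable on `s`. -/
def IsC1On (F : Space n → EReal) (s : Set (Space n)) : Prop :=
  (∀ x ∈ s, F x ≠ ⊥ ∧ F x ≠ ⊤) ∧ ContDiffOn ℝ 1 (fun x => (F x).toReal) s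

/-- The Bregman distance `D_h(y, x)`. -/
def breg (h : Space n → EReal) (y x : Space n) : EReal :=
  open Classical in
  if x ∈ interior (effDom h) then h y - h x - ((inner ℝ (grad h x) (y - x) : ℝ) : EReal) else ⊤

/-- `f` is `(L_1, …, L_N)`-smooth relative to `h`: for all `x ∈ dom h` and all `i`, the function
`z ↦ L_i h(x + U_i (z - x_i)) - f(x + U_i (z - x_i))`, which is `+∞` where `h` is, takes values
in `(-∞, ∞]` (so that `f < ∞` on `dom h`) and is convex. -/
def RelSmooth (L : Fin N → ℝ) (f h : Space n → EReal) : Prop :=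
  (∀ i, 0 ≤ L i) ∧ (∀ x ∈ effDom h, f x < ⊤) ∧
    ∀ x ∈ effDom h, ∀ i, ConvexOn ℝ (effDom (slice h x i))
      (fun z => L i * (slice h x i z).toReal - (slice f x i z).toReal)

/-- The objective `φ(x) = f(x) + ∑ g_i(x_i)`. -/
def objective (f : Space n → EReal) (g : (i : Fin N) → Block n i → EReal) (x : Space n) : EReal :=
  f x + ∑ i, g i (x i)

/-- The standing assumptions on `f`, `g_1, …, g_N`, the kernel `h` and `L_1, …, L_N`. -/
structure Standing (f h : Space n → EReal) (g : (i : Fin N) → Block n i → EReal)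
    (L : Fin N → ℝ) : Prop where
  g_proper : ∀ i, Proper (g i)
  g_lsc : ∀ i, LowerSemicontinuous (g i)
  f_proper : Proper f
  f_lsc : LowerSemicontinuous f
  f_C1 : IsC1On f (interior (effDom h))
  f_relSmooth : RelSmooth L f h
  h_proper : Proper h
  h_lsc : LowerSemicontinuous h
  h_interior : (interior (effDom h)).Nonempty
  h_C1 : IsC1On h (interior (effDom h))
  h_strictlyConvex : MultiBlockStrictlyConvex h
  h_oneCoercive : MultiBlockOneCoercive h
  h_essentiallySmooth : MultiBlockEssentiallySmooth h
  exists_min : (argmin (objective f g)).Nonempty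
  dom_subset : effDom (objective f g) ⊆ interior (effDom h)

/-- The model minimized in the `i`-th block: `⟨∇_i f(x), z - x_i⟩ + D_h(x + U_i (z - x_i), x)/γ
+ g_i(z)`. The terms `g_j(x_j)`, `j ≠ i`, do not depend on `z` and are left out. -/
def model (f h : Space n → EReal) (g : (i : Fin N) → Block n i → EReal) (γ : ℝ) (i : Fin N)
    (x : Space n) (z : Block n i) : EReal :=
  ((inner ℝ (grad f x i) (z - x i) : ℝ) : EReal)
    + ((1 / γ : ℝ) : EReal) * breg h (blockMove x i z) x + g i z

/-- The Bregman proximal alternating linearized mapping of the `i`-th block. It is empty unless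
`x` is in the interior of `dom h`. -/
def bpalMap (f h : Space n → EReal) (g : (i : Fin N) → Block n i → EReal) (γ : ℝ) (i : Fin N)
    (x : Space n) : Set (Block n i) :=
  argmin (model f h g γ i x)

/-- The point of the `k`-th cycle at which block `i` is updated: the blocks before `i` are those
of `x^{k+1}`, the block `i` and the blocks after it are those of `x^k`. -/
def partialIterate (x : ℕ → Space n) (k : ℕ) (i : Fin N) : Space n :=
  WithLp.toLp 2 (fun j => if j < i then x (k + 1) j else x k j)

/-- `x` is a sequence generated by BPALM with stepsizes `γ_i ∈ (0, 1/L_i)`, where `1/0 = ∞`. -/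
structure IsBPALM (f h : Space n → EReal) (g : (i : Fin N) → Block n i → EReal)
    (L γ : Fin N → ℝ) (x : ℕ → Space n) : Prop where
  stepsize : ∀ i, 0 < γ i ∧ γ i * L i < 1
  step : ∀ k i, x (k + 1) i ∈ bpalMap f h g (γ i) i (partialIterate x k i)

/-- The acceptance test of the backtracking linesearch:
`f(y) ≤ f(x) + ⟨∇_i f(x), z - x_i⟩ + l D_h(y, x)` with `y = x + U_i (z - x_i)`. -/
def DescentTest (f h : Space n → EReal) (l : ℝ) (i : Fin N) (x : Space n) (z : Block n i) : Prop :=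
  f (blockMove x i z) ≤ f x + ((inner ℝ (grad f x i) (z - x i) : ℝ) : EReal)
    + (l : EReal) * breg h (blockMove x i z) x

/-- `x` is a sequence generated by A-BPALM with backtracking factor `ν`, `Lb k i` and `γ k i`
being the current estimate of `L_i` and the current stepsize. In the `k`-th cycle the block `i` is
updated after trials `q = 0, 1, …, p`, with estimate `ν^q Lb k i` and stepsize `γ k i / ν^q`; the
trials `q < p` failed the test, and the trial `p` passed it. -/
structure IsABPALM (f h : Space n → EReal) (g : (i : Fin N) → Block n i → EReal)
    (L : Fin N → ℝ) (ν : ℝ) (Lb γ : ℕ → Fin N → ℝ) (x : ℕ → Space n) : Prop where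
  factor : 1 < ν
  initial_estimate : ∀ i, 0 < Lb 0 i ∧ Lb 0 i ≤ L i
  initial_stepsize : ∀ i, 0 < γ 0 i ∧ γ 0 i < 1 / Lb 0 i
  step : ∀ k i, ∃ p : ℕ,
    Lb (k + 1) i = ν ^ p * Lb k i ∧ γ (k + 1) i = γ k i / ν ^ p ∧
    x (k + 1) i ∈ bpalMap f h g (γ (k + 1) i) i (partialIterate x k i) ∧
    DescentTest f h (Lb (k + 1) i) i (partialIterate x k i) (x (k + 1) i) ∧
    ∀ q < p, ∃ z ∈ bpalMap f h g (γ k i / ν ^ q) i (partialIterate x k i),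
      ¬ DescentTest f h (ν ^ q * Lb k i) i (partialIterate x k i) z

/-- Finite length in every block, and convergence to a critical point of `φ`. -/
def GloballyConvergent (φ : Space n → EReal) (x : ℕ → Space n) : Prop :=
  (∀ i, Summable (fun k => ‖x (k + 1) i - x k i‖)) ∧
    ∃ xs, Tendsto x atTop (𝓝 xs) ∧ xs ∈ crit φ

end BPALM

end

open Filter Topology

noncomputable section

namespace BPALM

/-! Both algorithms are instances of one scheme, `IsDescentSequence`: Bregman proximal block steps
with stepsizes bounded away from zero, each passing the descent test with an estimate below the
inverse stepsize by a uniform gap `c`. Three facts about such a cycle carry the proof.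

Decrease (`IsDescentSequence.descent`): comparing each block minimizer with the old block and adding
the descent test lowers `φ` by at least `c` times a Bregman distance, which strong convexity bounds
below by a squared block displacement.

Relative error (`stepSubgrad_mem`, `norm_stepSubgrad_le`): the block optimality conditions assemble
into a subgradient of `φ` at `x^{k+1}` made only of gradient differences. Where `∇f` and `∇h` are
Lipschitz, its norm is at most a constant times `‖x^{k+1} - x^k‖`.

Continuity of values (`IsDescentSequence.le_objReal`): at a cluster point `φ` equals the limit of
`φ(x^k)`. Lower semicontinuity gives one inequality, optimality of the block steps tested at the
cluster point the other.

A cluster point lies in `dom φ`, hence inside `int dom h`, where local Lipschitz constants exist,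
and it is critical because the subgradients tend to zero. The KL inequality there turns decrease and
relative error into finite length (`summable_of_kl`), so the whole sequence converges to it. -/

/-! ### Tangent inequalities and the abstract finite-length argument -/

/-- The gradient inequality for a strongly convex function on a set, at a point of
differentiability. -/
theorem _root_.StrongConvexOn.gradient_le {E : Type*} [NormedAddCommGroup E] [NormedSpace ℝ E]
    {S : Set E} {σ : ℝ} {F : E → ℝ} (hF : StrongConvexOn S σ F) {x z : E} (hx : x ∈ S)
    (hz : z ∈ S) {F' : E →L[ℝ] ℝ} (hd : HasFDerivAt F F' x) :
    F x + F' (z - x) + σ / 2 * ‖z - x‖ ^ 2 ≤ F z := by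
  have h1 : HasDerivAt (fun t : ℝ => F (x + t • (z - x))) (F' (z - x)) 0 := by
    have h2 : HasDerivAt (fun t : ℝ => x + t • (z - x)) (z - x) 0 := by
      simpa using ((hasDerivAt_id (0 : ℝ)).smul_const (z - x)).const_add x
    have h3 : HasFDerivAt F F' (x + (0 : ℝ) • (z - x)) := by simpa using hd
    exact h3.comp_hasDerivAt (0 : ℝ) h2
  have h4 : Tendsto (fun t : ℝ => t⁻¹ • (F (x + (0 + t) • (z - x)) - F (x + (0 : ℝ) • (z - x))))
      (𝓝[>] 0) (𝓝 (F' (z - x))) :=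
    (hasDerivAt_iff_tendsto_slope_zero.1 h1).mono_left
      (nhdsWithin_mono _ fun t ht => (ne_of_gt ht : t ≠ 0))
  have h5 : Tendsto (fun t : ℝ => F z - F x - σ / 2 * (1 - t) * ‖z - x‖ ^ 2) (𝓝[>] 0)
      (𝓝 (F z - F x - σ / 2 * (1 - 0) * ‖z - x‖ ^ 2)) := by
    apply Tendsto.mono_left _ nhdsWithin_le_nhds
    apply Continuous.tendsto
    fun_prop
  have h6 : F' (z - x) ≤ F z - F x - σ / 2 * (1 - 0) * ‖z - x‖ ^ 2 := by
    refine le_of_tendsto_of_tendsto h4 h5 ?_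
    -- Strong convexity at `(1 - t) x + t z`, divided by `t`, bounds the difference quotient; then
    -- `t` decreases to 0.
    filter_upwards [Ioo_mem_nhdsGT (zero_lt_one' ℝ)] with t ht
    have h7 := hF.2 hx hz (by linarith [ht.2] : 0 ≤ 1 - t) ht.1.le (by ring)
    have h8 : (1 - t) • x + t • z = x + t • (z - x) := by module
    rw [h8, norm_sub_rev] at h7
    simp only [zero_add, zero_smul, add_zero, smul_eq_mul] at h7 ⊢
    rw [inv_mul_le_iff₀ ht.1]
    nlinarith [h7]
  linarith

/-- A concave function lies below its tangents. -/
theorem _root_.ConcaveOn.le_tangent {S : Set ℝ} {ψ : ℝ → ℝ} (hψ : ConcaveOn ℝ S ψ) {t y : ℝ}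
    (ht : t ∈ S) (hy : y ∈ S) (hd : DifferentiableAt ℝ ψ t) :
    ψ y ≤ ψ t + deriv ψ t * (y - t) := by
  have h1 : StrongConvexOn S 0 (-ψ) := strongConvexOn_zero.2 hψ.neg
  have h2 := h1.gradient_le ht hy (hd.hasDerivAt.neg.hasFDerivAt)
  simp at h2
  linarith [h2]

/-- Consecutive differences tend to zero under sufficient decrease of a convergent sequence. -/
theorem tendsto_norm_sub_of_descent {E : Type*} [NormedAddCommGroup E] {x : ℕ → E} {s : ℕ → ℝ}
    {a b : ℝ} (ha : 0 < a) (hdesc : ∀ k, a * ‖x (k + 1) - x k‖ ^ 2 ≤ s k - s (k + 1))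
    (hs : Tendsto s atTop (𝓝 b)) : Tendsto (fun k => ‖x (k + 1) - x k‖) atTop (𝓝 0) := by
  have h1 : Tendsto (fun k => (s k - s (k + 1)) / a) atTop (𝓝 0) := by
    simpa using (hs.sub (hs.comp (tendsto_add_atTop_nat 1))).div_const a
  have h2 : Tendsto (fun k => ‖x (k + 1) - x k‖ ^ 2) atTop (𝓝 0) :=
    squeeze_zero (fun k => sq_nonneg _)
      (fun k => by rw [le_div_iff₀ ha]; linarith [hdesc k]) h1
  simpa [Real.sqrt_sq] using h2.sqrt

/-- A sequence with sufficient decrease has finite length if the Kurdyka–Łojasiewicz inequality,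
combined with a relative bound on subgradients, holds near one of its cluster points. -/
theorem summable_of_kl {E : Type*} [NormedAddCommGroup E] {x : ℕ → E} {xs : E} {s : ℕ → ℝ}
    {θ : ℕ → ℕ} (hθ : StrictMono θ) (hx : Tendsto (x ∘ θ) atTop (𝓝 xs)) {a M r η : ℝ}
    {ψ : ℝ → ℝ} (ha : 0 < a) (hM : 0 ≤ M) (hr : 0 < r) (hη : 0 < η)
    (hdesc : ∀ k, a * ‖x (k + 1) - x k‖ ^ 2 ≤ s k - s (k + 1))
    (hs0 : ∀ k, 0 ≤ s k) (hs : Tendsto s atTop (𝓝 0)) (hψ : ConcaveOn ℝ (Set.Icc 0 η) ψ)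
    (hψ0 : ∀ t ∈ Set.Icc 0 η, 0 ≤ ψ t) (hψd : ∀ t ∈ Set.Ioo 0 η, DifferentiableAt ℝ ψ t)
    (hkl : ∀ k, x k ∈ Metric.ball xs r → x (k + 1) ∈ Metric.ball xs r → 0 < s (k + 1) →
      s (k + 1) < η → 1 ≤ deriv ψ (s (k + 1)) * (M * ‖x (k + 1) - x k‖)) :
    Summable (fun k => ‖x (k + 1) - x k‖) := by
  set d : ℕ → ℝ := fun k => ‖x (k + 1) - x k‖ with hd
  have hd0 : ∀ k, 0 ≤ d k := fun k => norm_nonneg _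
  have hanti : Antitone s := antitone_nat_of_succ_le fun k => by
    nlinarith [hdesc k, mul_nonneg ha.le (sq_nonneg (d k))]
  have hdt : Tendsto d atTop (𝓝 0) := tendsto_norm_sub_of_descent ha hdesc hs
  -- Once the gap `s` vanishes it stays zero, and the decrease inequality freezes the sequence.
  by_cases hz : ∃ k, s k = 0
  · obtain ⟨k, hk⟩ := hz
    rw [← summable_nat_add_iff k]
    have : (fun j => d (j + k)) = fun _ => 0 := by
      funext j
      have h1 : s (j + k) ≤ 0 := hk ▸ hanti (by omega)
      have h2 := hdesc (j + k)
      have h3 := hs0 (j + k + 1)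
      have h4 : d (j + k) ^ 2 ≤ 0 := by
        by_contra! h5
        nlinarith [mul_pos ha h5]
      exact pow_eq_zero_iff (two_ne_zero) |>.1 (le_antisymm h4 (sq_nonneg _))
    rw [this]
    exact summable_zero
  push Not at hz
  have hpos : ∀ k, 0 < s k := fun k => lt_of_le_of_ne (hs0 k) (hz k).symm
  have hθt := hθ.tendsto_atTop
  have hx1 : Tendsto (fun j => x (θ j + 1)) atTop (𝓝 xs) := by
    have h1 : Tendsto (fun j => x (θ j + 1) - x (θ j)) atTop (𝓝 0) :=
      tendsto_zero_iff_norm_tendsto_zero.2 (hdt.comp hθt)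
    simpa using h1.add hx
  have hsη : ∀ᶠ k in atTop, s k < η := hs.eventually_lt_const hη
  -- `ψ` is not assumed monotone. The KL inequality at a single iterate forces a positive derivative
  -- there, and concavity passes the sign on to all smaller gaps.
  obtain ⟨m₀, hm₀η, hD⟩ : ∃ m, s m < η ∧ 0 < deriv ψ (s m) := by
    have e1 := hx.eventually (Metric.ball_mem_nhds xs hr)
    have e2 := hx1.eventually (Metric.ball_mem_nhds xs hr)
    have e3 := hθt.eventually ((tendsto_add_atTop_nat 1).eventually hsη)
    obtain ⟨j, h1, h2, h3⟩ := (e1.and (e2.and e3)).exists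
    refine ⟨θ j + 1, h3, ?_⟩
    have h4 := hkl (θ j) h1 h2 (hpos _) h3
    by_contra! h5
    nlinarith [mul_nonneg hM (hd0 (θ j))]
  have hmem : ∀ k, m₀ ≤ k → s k ∈ Set.Ioo 0 η := fun k hk =>
    ⟨hpos k, (hanti hk).trans_lt hm₀η⟩
  have htan : ∀ j k, m₀ ≤ j → m₀ ≤ k → ψ (s j) ≤ ψ (s k) + deriv ψ (s k) * (s j - s k) :=
    fun j k hj hk => hψ.le_tangent (Set.Ioo_subset_Icc_self (hmem k hk))
      (Set.Ioo_subset_Icc_self (hmem j hj)) (hψd _ (hmem k hk))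
  have hDk : ∀ k, m₀ ≤ k → 0 ≤ deriv ψ (s k) := by
    intro k hk
    rcases (hanti hk).eq_or_lt with h | h
    · rw [h]; exact hD.le
    · have h1 := htan k m₀ hk le_rfl
      have h2 := htan m₀ k le_rfl hk
      by_contra! h3
      nlinarith [mul_pos hD (sub_pos.2 h), mul_pos_of_neg_of_neg h3 (sub_neg.2 h)]
  have hψanti : ∀ k, m₀ ≤ k → ψ (s (k + 1)) ≤ ψ (s k) := fun k hk => by
    have h1 := htan (k + 1) k (by omega) hk
    have h2 := mul_nonneg (hDk k hk) (sub_nonneg.2 (hanti (Nat.le_succ k)))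
    simp only [Nat.succ_eq_add_one] at h2
    nlinarith
  have hbanti : Antitone fun k => ψ (s (k + m₀)) := antitone_nat_of_succ_le fun k => by
    have := hψanti (k + m₀) (by omega)
    rwa [show k + m₀ + 1 = k + 1 + m₀ by ring] at this
  have hbdd : BddBelow (Set.range fun k => ψ (s (k + m₀))) := by
    refine ⟨0, ?_⟩
    rintro _ ⟨k, rfl⟩
    exact hψ0 _ (Set.Ioo_subset_Icc_self (hmem _ (by omega)))
  -- `ψ` need not be continuous at 0, so `ψ (s k)` is telescoped against its own limit `l`, which
  -- may be positive.
  obtain ⟨l, hl, hlt⟩ : ∃ l, (∀ k, m₀ ≤ k → l ≤ ψ (s k)) ∧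
      Tendsto (fun k => ψ (s k)) atTop (𝓝 l) := by
    refine ⟨⨅ k, ψ (s (k + m₀)), fun k hk => ?_, ?_⟩
    · simpa [Nat.sub_add_cancel hk] using ciInf_le hbdd (k - m₀)
    · exact (tendsto_add_atTop_iff_nat (f := fun k => ψ (s k)) m₀).1
        (tendsto_atTop_ciInf hbanti hbdd)
  set c := M / a with hc
  have hc0 : 0 ≤ c := div_nonneg hM ha.le
  -- Four quarters of `r` are spent below: the distance to `xs`, the tail of `ψ`, and `d K` twice,
  -- once as the step from `K` to `K + 1` and once as the start of the telescoping sum.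
  obtain ⟨K, hK1, hK2, hKm, hK3⟩ : ∃ K, dist (x K) xs < r / 4 ∧ d K < r / 4 ∧ m₀ ≤ K ∧
      c * (ψ (s (K + 1)) - l) < r / 4 := by
    have e1 := hx.eventually (Metric.ball_mem_nhds xs (by linarith : 0 < r / 4))
    have e2 := hθt.eventually (hdt.eventually_lt_const (by linarith : 0 < r / 4))
    have e3 := hθt.eventually (eventually_ge_atTop m₀)
    have h4 : Tendsto (fun k => c * (ψ (s (k + 1)) - l)) atTop (𝓝 0) := by
      simpa using ((hlt.comp (tendsto_add_atTop_nat 1)).sub_const l).const_mul c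
    have e4 := hθt.eventually (h4.eventually_lt_const (by linarith : 0 < r / 4))
    obtain ⟨j, h1, h2, h3, h4⟩ := (e1.and (e2.and (e3.and e4))).exists
    exact ⟨θ j, h1, h2, h3, h4⟩
  have hrec : ∀ k, m₀ ≤ k → x k ∈ Metric.ball xs r → x (k + 1) ∈ Metric.ball xs r →
      d (k + 1) ≤ (d k - d (k + 1)) + c * (ψ (s (k + 1)) - ψ (s (k + 2))) := by
    intro k hk h1 h2
    have h3 := hkl k h1 h2 (hpos _) (hmem (k + 1) (by omega)).2
    have h4 := htan (k + 2) (k + 1) (by omega) (by omega)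
    have h5 := hdesc (k + 1)
    have h6 := hψanti (k + 1) (by omega)
    have h7 : s (k + 2) ≤ s (k + 1) := hanti (by omega)
    set D := deriv ψ (s (k + 1))
    set Δ := ψ (s (k + 1)) - ψ (s (k + 2)) with hΔ
    have hΔ0 : 0 ≤ Δ := sub_nonneg.2 h6
    have h8 : D * (s (k + 1) - s (k + 2)) ≤ Δ := by rw [hΔ]; nlinarith
    have hMd : 0 ≤ M * d k := mul_nonneg hM (hd0 k)
    have h9 : a * d (k + 1) ^ 2 ≤ Δ * (M * d k) :=
      calc a * d (k + 1) ^ 2 ≤ (s (k + 1) - s (k + 2)) * 1 := by simpa using h5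
        _ ≤ (s (k + 1) - s (k + 2)) * (D * (M * d k)) :=
          mul_le_mul_of_nonneg_left h3 (sub_nonneg.2 h7)
        _ = D * (s (k + 1) - s (k + 2)) * (M * d k) := by ring
        _ ≤ Δ * (M * d k) := mul_le_mul_of_nonneg_right h8 hMd
    have h10 : d (k + 1) ^ 2 ≤ c * Δ * d k := by
      have : d (k + 1) ^ 2 ≤ Δ * (M * d k) / a := by rw [le_div_iff₀ ha]; linarith
      calc _ ≤ _ := this
        _ = _ := by rw [hc]; ring
    -- AM-GM, `4 u v ≤ (u + v)²`, applied to `d k` and `c * Δ`.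
    have h11 : (2 * d (k + 1)) ^ 2 ≤ (d k + c * Δ) ^ 2 := by
      nlinarith [sq_nonneg (d k - c * Δ)]
    have h12 := (sq_le_sq₀ (by linarith [hd0 (k + 1)])
      (add_nonneg (hd0 k) (mul_nonneg hc0 hΔ0))).1 h11
    linarith
  -- Staying in the ball and the length bound are proved together: the bound keeps the next iterate
  -- in the ball, and two consecutive iterates in the ball allow the next use of KL.
  have hmain : ∀ m, x (K + m) ∈ Metric.ball xs r ∧ x (K + m + 1) ∈ Metric.ball xs r ∧
      ∑ i ∈ Finset.range m, d (K + 1 + i) ≤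
        d K - d (K + m) + c * (ψ (s (K + 1)) - ψ (s (K + m + 1))) := by
    intro m
    induction m with
    | zero =>
      refine ⟨?_, ?_, by simp⟩
      · rw [Metric.mem_ball, add_zero]; linarith
      · rw [Metric.mem_ball, add_zero]
        calc dist (x (K + 1)) xs ≤ dist (x (K + 1)) (x K) + dist (x K) xs := dist_triangle _ _ _
          _ = d K + dist (x K) xs := by rw [dist_eq_norm]
          _ < r := by linarith
    | succ m ih =>
      obtain ⟨h1, h2, h3⟩ := ih
      have h4 := hrec (K + m) (by omega) h1 h2
      have h5 : ∑ i ∈ Finset.range (m + 1), d (K + 1 + i) ≤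
          d K - d (K + (m + 1)) + c * (ψ (s (K + 1)) - ψ (s (K + (m + 1) + 1))) := by
        rw [Finset.sum_range_succ, show K + 1 + m = K + m + 1 by ring,
          show K + (m + 1) = K + m + 1 by ring]
        nlinarith
      refine ⟨h2, ?_, h5⟩
      have h6 := dist_le_range_sum_dist (fun i => x (K + 1 + i)) (m + 1)
      have h7 : ∑ i ∈ Finset.range (m + 1), dist (x (K + 1 + i)) (x (K + 1 + (i + 1))) =
          ∑ i ∈ Finset.range (m + 1), d (K + 1 + i) :=
        Finset.sum_congr rfl fun i _ => by rw [dist_comm, dist_eq_norm]; rfl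
      rw [h7] at h6
      have h8 : c * (ψ (s (K + 1)) - ψ (s (K + (m + 1) + 1))) ≤ c * (ψ (s (K + 1)) - l) :=
        mul_le_mul_of_nonneg_left (by linarith [hl (K + (m + 1) + 1) (by omega)]) hc0
      have h9 : dist (x (K + 1)) (x K) = d K := by rw [dist_eq_norm]
      simp only [add_zero] at h6
      rw [show K + 1 + (m + 1) = K + (m + 1) + 1 by ring] at h6
      rw [Metric.mem_ball]
      have t1 := dist_triangle (x (K + (m + 1) + 1)) (x (K + 1)) xs
      have t2 := dist_triangle (x (K + 1)) (x K) xs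
      have t3 := dist_comm (x (K + (m + 1) + 1)) (x (K + 1))
      linarith [hd0 (K + (m + 1))]
  rw [← summable_nat_add_iff (K + 1)]
  refine summable_of_sum_range_le (c := d K + c * (ψ (s (K + 1)) - l)) (fun k => hd0 _) fun m => ?_
  have h1 := (hmain m).2.2
  have h8 : c * (ψ (s (K + 1)) - ψ (s (K + m + 1))) ≤ c * (ψ (s (K + 1)) - l) :=
    mul_le_mul_of_nonneg_left (by linarith [hl (K + m + 1) (by omega)]) hc0
  have h9 : ∑ i ∈ Finset.range m, d (i + (K + 1)) = ∑ i ∈ Finset.range m, d (K + 1 + i) :=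
    Finset.sum_congr rfl fun i _ => by rw [add_comm]
  rw [h9]
  linarith [hd0 (K + m)]

/-! ### Sums of extended reals that avoid `⊥` -/

section ExtendedReal

variable {ι : Type*}

theorem sum_ne_bot {s : Finset ι} {u : ι → EReal} (hu : ∀ i, u i ≠ ⊥) : ∑ i ∈ s, u i ≠ ⊥ := by
  classical
  induction s using Finset.induction_on with
  | empty => simp
  | insert i s hi ih =>
    rw [Finset.sum_insert hi, Ne, EReal.add_eq_bot_iff]
    exact not_or.2 ⟨hu i, ih⟩

theorem sum_ne_top_iff {s : Finset ι} {u : ι → EReal} (hu : ∀ i, u i ≠ ⊥) :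
    ∑ i ∈ s, u i ≠ ⊤ ↔ ∀ i ∈ s, u i ≠ ⊤ := by
  classical
  induction s using Finset.induction_on with
  | empty => simp
  | insert i s hi ih =>
    rw [Finset.sum_insert hi, EReal.add_ne_top_iff_ne_top₂ (hu i) (sum_ne_bot hu), ih,
      Finset.forall_mem_insert]

theorem sum_eq_coe {s : Finset ι} {u : ι → EReal} (hu : ∀ i, u i ≠ ⊥) (hu' : ∀ i, u i ≠ ⊤) :
    ∑ i ∈ s, u i = ((∑ i ∈ s, (u i).toReal : ℝ) : EReal) := by
  classical
  induction s using Finset.induction_on with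
  | empty => simp
  | insert i s hi ih =>
    rw [Finset.sum_insert hi, Finset.sum_insert hi, ih, EReal.coe_add,
      EReal.coe_toReal (hu' i) (hu i)]

theorem lowerSemicontinuous_add_of_ne_bot {X : Type*} [TopologicalSpace X] {F G : X → EReal}
    (hF : LowerSemicontinuous F) (hG : LowerSemicontinuous G) (hF' : ∀ x, F x ≠ ⊥)
    (hG' : ∀ x, G x ≠ ⊥) : LowerSemicontinuous fun x => F x + G x :=
  hF.add' hG fun x => EReal.continuousAt_add (Or.inr (hG' x)) (Or.inl (hF' x))

theorem lowerSemicontinuous_sum_of_ne_bot {X : Type*} [TopologicalSpace X] {s : Finset ι}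
    {F : ι → X → EReal} (hF : ∀ i, LowerSemicontinuous (F i)) (hF' : ∀ i x, F i x ≠ ⊥) :
    LowerSemicontinuous fun x => ∑ i ∈ s, F i x := by
  classical
  induction s using Finset.induction_on with
  | empty => simpa using lowerSemicontinuous_const
  | insert i s hi ih =>
    simp only [Finset.sum_insert hi]
    exact lowerSemicontinuous_add_of_ne_bot (hF i) ih (hF' i)
      fun x => sum_ne_bot fun j => hF' j x

end ExtendedReal

/-! ### Block embeddings and partial gradients -/

variable {N : ℕ} {n : Fin N → ℕ}

/-- The isometric embedding `U_i` of the `i`-th block. -/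
def blockEmbed (i : Fin N) : Block n i →ₗᵢ[ℝ] Space n where
  toFun := PiLp.single 2 i
  map_add' _ _ := PiLp.single_add 2 i
  map_smul' c u := by
    rw [← PiLp.toLp_single, ← PiLp.toLp_single, Pi.single_smul]
    rfl
  norm_map' u := PiLp.norm_single 2 _ i u

theorem blockMove_apply (x : Space n) (i : Fin N) (z : Block n i) (j : Fin N) :
    blockMove x i z j = Function.update (WithLp.ofLp x) i z j := rfl

@[simp] theorem blockMove_same (x : Space n) (i : Fin N) (z : Block n i) :
    blockMove x i z i = z := by
  rw [blockMove_apply, Function.update_self]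

theorem blockMove_of_ne (x : Space n) {i j : Fin N} (hj : j ≠ i) (z : Block n i) :
    blockMove x i z j = x j := by
  rw [blockMove_apply, Function.update_of_ne hj]

@[simp] theorem blockMove_self (x : Space n) (i : Fin N) : blockMove x i (x i) = x := by
  ext1 j
  rw [blockMove_apply, Function.update_eq_self]

theorem blockEmbed_same (i : Fin N) (u : Block n i) : (blockEmbed i u : Space n) i = u :=
  PiLp.single_eq_same 2 i u

theorem blockEmbed_of_ne {i j : Fin N} (hj : j ≠ i) (u : Block n i) :
    (blockEmbed i u : Space n) j = 0 :=
  PiLp.single_eq_of_ne 2 hj u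

theorem blockMove_sub (x : Space n) (i : Fin N) (z z' : Block n i) :
    blockMove x i z - blockMove x i z' = blockEmbed i (z - z') := by
  ext1 j
  by_cases hj : j = i
  · subst hj; simp [blockEmbed_same]
  · simp [blockEmbed_of_ne hj, blockMove_of_ne _ hj]

theorem blockMove_eq (x : Space n) (i : Fin N) (z : Block n i) :
    blockMove x i z = x + blockEmbed i (z - x i) := by
  rw [← blockMove_sub, blockMove_self, add_sub_cancel]

theorem blockMove_sub_self (x : Space n) (i : Fin N) (z : Block n i) :
    blockMove x i z - x = blockEmbed i (z - x i) := by
  rw [blockMove_eq, add_sub_cancel_left]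

theorem inner_blockEmbed (w : Space n) (i : Fin N) (u : Block n i) :
    inner ℝ w (blockEmbed i u) = inner ℝ (w i) u := by
  rw [PiLp.inner_apply, Finset.sum_eq_single i]
  · rw [blockEmbed_same]
  · intro j _ hj
    rw [blockEmbed_of_ne hj, inner_zero_right]
  · simp

theorem sum_blockEmbed (w : Space n) : ∑ i, blockEmbed i (w i) = w := by
  ext1 j
  rw [WithLp.ofLp_sum, Finset.sum_apply, Finset.sum_eq_single j]
  · exact blockEmbed_same j _
  · intro i _ hi
    exact blockEmbed_of_ne hi.symm _
  · simp

theorem norm_le_sum_norm (w : Space n) : ‖w‖ ≤ ∑ i, ‖w i‖ := by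
  conv_lhs => rw [← sum_blockEmbed w]
  exact (norm_sum_le _ _).trans_eq (Finset.sum_congr rfl fun i _ => (blockEmbed i).norm_map _)

theorem continuous_blockMove (x : Space n) (i : Fin N) : Continuous (blockMove x i) := by
  have : blockMove x i = fun z => x + blockEmbed i (z - x i) := funext (blockMove_eq x i)
  rw [this]
  exact continuous_const.add ((blockEmbed i).continuous.comp (continuous_id.sub continuous_const))

theorem hasFDerivAt_blockMove (x : Space n) (i : Fin N) (z : Block n i) :
    HasFDerivAt (blockMove x i) (blockEmbed i).toContinuousLinearMap z := by
  have : blockMove x i = fun z => x + (blockEmbed i).toContinuousLinearMap (z - x i) :=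
    funext (blockMove_eq x i)
  rw [this]
  exact ((blockEmbed i).toContinuousLinearMap.hasFDerivAt.comp z
    ((hasFDerivAt_id z).sub_const (x i))).const_add x

theorem sum_blockMove (G : (i : Fin N) → Block n i → ℝ) (x : Space n) (i : Fin N)
    (z : Block n i) :
    ∑ j, G j (blockMove x i z j) = ∑ j, G j (x j) - G i (x i) + G i z := by
  rw [← Finset.add_sum_erase _ _ (Finset.mem_univ i),
    ← Finset.add_sum_erase _ (fun j => G j (x j)) (Finset.mem_univ i), blockMove_same]
  rw [Finset.sum_congr rfl fun j hj => by rw [blockMove_of_ne x (Finset.ne_of_mem_erase hj) z]]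
  ring

/-- The gradient of an extended-real-valued function that is `C^1` on an open set. -/
theorem IsC1On.hasFDerivAt {F : Space n → EReal} {s : Set (Space n)} (hF : IsC1On F s)
    (hs : IsOpen s) {x : Space n} (hx : x ∈ s) :
    HasFDerivAt (fun y => (F y).toReal) (InnerProductSpace.toDual ℝ _ (grad F x)) x :=
  hasGradientAt_iff_hasFDerivAt.1
    (((hF.2.differentiableOn one_ne_zero).differentiableAt (hs.mem_nhds hx)).hasGradientAt)

theorem IsC1On.hasFDerivAt_slice {F : Space n → EReal} {s : Set (Space n)} (hF : IsC1On F s)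
    (hs : IsOpen s) {x : Space n} (hx : x ∈ s) (i : Fin N) :
    HasFDerivAt (fun z => (slice F x i z).toReal) (InnerProductSpace.toDual ℝ _ (grad F x i))
      (x i) := by
  have h1 : HasFDerivAt (fun y => (F y).toReal) (InnerProductSpace.toDual ℝ _ (grad F x))
      (blockMove x i (x i)) := by
    rw [blockMove_self]
    exact hF.hasFDerivAt hs hx
  have h2 : InnerProductSpace.toDual ℝ (Block n i) (grad F x i) =
      (InnerProductSpace.toDual ℝ (Space n) (grad F x)).comp
        (blockEmbed i).toContinuousLinearMap := by
    ext u
    exact (inner_blockEmbed _ _ _).symm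
  rw [h2]
  exact h1.comp (x i) (hasFDerivAt_blockMove x i (x i))

theorem IsC1On.eventually_abs_le {F : Space n → EReal} {s : Set (Space n)} (hF : IsC1On F s)
    (hs : IsOpen s) {x : Space n} (hx : x ∈ s) {ε : ℝ} (hε : 0 < ε) :
    ∀ᶠ y in 𝓝 x, |(F y).toReal - (F x).toReal - inner ℝ (grad F x) (y - x)| ≤ ε * ‖y - x‖ := by
  have h1 := (hasFDerivAt_iff_isLittleO.1 (hF.hasFDerivAt hs hx)).def hε
  filter_upwards [h1] with y hy
  simpa using hy

/-! ### The proximal step and the subgradients in real terms -/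

/-- The Bregman distance as a real number. -/
def bregReal (h : Space n → EReal) (y x : Space n) : ℝ :=
  (h y).toReal - (h x).toReal - inner ℝ (grad h x) (y - x)

/-- The objective as a sum of real numbers, meaningful on its domain. -/
def objReal (f : Space n → EReal) (g : (i : Fin N) → Block n i → EReal) (x : Space n) : ℝ :=
  (f x).toReal + ∑ i, (g i (x i)).toReal

section

variable {f h : Space n → EReal} {g : (i : Fin N) → Block n i → EReal} {L σ : Fin N → ℝ}

theorem Standing.mem_effDom_objective_iff (S : Standing f h g L) {x : Space n} :
    x ∈ effDom (objective f g) ↔ f x < ⊤ ∧ ∀ i, g i (x i) < ⊤ := by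
  change objective f g x < ⊤ ↔ _
  rw [lt_top_iff_ne_top, objective, EReal.add_ne_top_iff_ne_top₂ (S.f_proper.1 x)
    (sum_ne_bot fun i => (S.g_proper i).1 _), sum_ne_top_iff fun i => (S.g_proper i).1 _]
  simp [lt_top_iff_ne_top]

theorem Standing.objective_eq (S : Standing f h g L) {x : Space n}
    (hx : x ∈ effDom (objective f g)) : objective f g x = (objReal f g x : EReal) := by
  obtain ⟨h1, h2⟩ := S.mem_effDom_objective_iff.1 hx
  rw [objective, objReal, EReal.coe_add, EReal.coe_toReal h1.ne (S.f_proper.1 x),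
    sum_eq_coe (fun i => (S.g_proper i).1 _) fun i => (h2 i).ne]

theorem Standing.objective_lsc (S : Standing f h g L) :
    LowerSemicontinuous (objective f g) :=
  lowerSemicontinuous_add_of_ne_bot S.f_lsc
    (lowerSemicontinuous_sum_of_ne_bot
      (fun i => (S.g_lsc i).comp (g := fun x : Space n => x i) (by fun_prop))
      fun i x => (S.g_proper i).1 _)
    S.f_proper.1 fun x => sum_ne_bot fun i => (S.g_proper i).1 _

theorem Standing.breg_eq (S : Standing f h g L) {x y : Space n}
    (hx : x ∈ interior (effDom h)) (hy : y ∈ effDom h) :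
    breg h y x = (bregReal h y x : EReal) := by
  have h1 := S.h_C1.1 x hx
  rw [breg, if_pos hx, bregReal, EReal.coe_sub, EReal.coe_sub,
    EReal.coe_toReal (ne_of_lt hy) (S.h_proper.1 y), EReal.coe_toReal h1.2 h1.1]

theorem Standing.breg_eq_top (S : Standing f h g L) {x y : Space n} (hy : y ∉ effDom h) :
    breg h y x = ⊤ := by
  rw [breg]
  split_ifs with hx
  · have h1 := S.h_C1.1 x hx
    have h2 : h y = ⊤ := not_lt_top_iff.1 hy
    rw [h2, ← EReal.coe_toReal h1.2 h1.1, EReal.top_sub_coe, EReal.top_sub_coe]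
  · rfl

theorem Standing.model_eq (S : Standing f h g L) {γ : ℝ} {i : Fin N} {x : Space n}
    {z : Block n i} (hx : x ∈ interior (effDom h)) (hy : blockMove x i z ∈ effDom h)
    (hg : g i z < ⊤) :
    model f h g γ i x z = ((inner ℝ (grad f x i) (z - x i)
      + 1 / γ * bregReal h (blockMove x i z) x + (g i z).toReal : ℝ) : EReal) := by
  rw [model, S.breg_eq hx hy, EReal.coe_add, EReal.coe_add, EReal.coe_mul,
    EReal.coe_toReal hg.ne ((S.g_proper i).1 z)]

/-- The optimality of a point of the proximal mapping, in terms of real numbers. -/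
theorem Standing.bpalMap_spec (S : Standing f h g L) {γ : ℝ} (hγ : 0 < γ) {i : Fin N}
    {x : Space n} {z : Block n i} (hz : z ∈ bpalMap f h g γ i x) :
    x ∈ interior (effDom h) ∧ blockMove x i z ∈ effDom h ∧ g i z < ⊤ ∧
      ∀ z', blockMove x i z' ∈ effDom h → g i z' < ⊤ →
        inner ℝ (grad f x i) (z - x i) + 1 / γ * bregReal h (blockMove x i z) x + (g i z).toReal ≤
        inner ℝ (grad f x i) (z' - x i) + 1 / γ * bregReal h (blockMove x i z') x
          + (g i z').toReal := by
  obtain ⟨h1, h2⟩ := hz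
  have hγ' : 0 < 1 / γ := one_div_pos.2 hγ
  -- Since `⊤ + ⊥ = ⊥` in `EReal`, a model value below `⊤` makes a term finite only after `⊥` is
  -- excluded for the others.
  have hg : g i z < ⊤ := by
    rw [lt_top_iff_ne_top]
    intro h3
    rw [model, h3] at h1
    refine h1.ne (EReal.add_top_of_ne_bot ?_)
    by_cases hx : x ∈ interior (effDom h)
    · by_cases hy : blockMove x i z ∈ effDom h
      · rw [S.breg_eq hx hy, ← EReal.coe_mul, ← EReal.coe_add]
        exact EReal.coe_ne_bot _
      · rw [S.breg_eq_top hy, EReal.coe_mul_top_of_pos hγ', EReal.coe_add_top]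
        exact top_ne_bot
    · rw [breg, if_neg hx, EReal.coe_mul_top_of_pos hγ', EReal.coe_add_top]
      exact top_ne_bot
  have htop : breg h (blockMove x i z) x ≠ ⊤ := by
    intro h3
    rw [model, h3, EReal.coe_mul_top_of_pos hγ', EReal.coe_add_top,
      EReal.top_add_of_ne_bot ((S.g_proper i).1 z)] at h1
    exact h1.ne rfl
  have hx : x ∈ interior (effDom h) := by
    by_contra hx
    exact htop (by rw [breg, if_neg hx])
  have hy : blockMove x i z ∈ effDom h := by
    by_contra hy
    exact htop (S.breg_eq_top hy)
  refine ⟨hx, hy, hg, fun z' hy' hg' => ?_⟩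
  have h4 := h2 z'
  rwa [S.model_eq hx hy hg, S.model_eq hx hy' hg', EReal.coe_le_coe_iff] at h4

theorem bregReal_blockMove (h : Space n → EReal) (x : Space n) (i : Fin N) (z : Block n i) :
    bregReal h (blockMove x i z) x =
      (h (blockMove x i z)).toReal - (h x).toReal - inner ℝ (grad h x i) (z - x i) := by
  rw [bregReal, blockMove_sub_self, inner_blockEmbed]

/-- Strong convexity bounds the Bregman distance below. -/
theorem Standing.le_bregReal (S : Standing f h g L) (hσ : MultiBlockStronglyConvex σ h)
    {x : Space n} (hx : x ∈ interior (effDom h)) (i : Fin N) {z : Block n i}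
    (hy : blockMove x i z ∈ effDom h) :
    σ i / 2 * ‖z - x i‖ ^ 2 ≤ bregReal h (blockMove x i z) x := by
  have h1 := (hσ.2 x (interior_subset hx) i).gradient_le (x := x i) (z := z)
    (by change h (blockMove x i (x i)) < ⊤; rw [blockMove_self]; exact (interior_subset hx : x ∈ effDom h)) hy
    (S.h_C1.hasFDerivAt_slice isOpen_interior hx i)
  simp only [slice, blockMove_self, InnerProductSpace.toDual_apply_apply] at h1
  rw [bregReal_blockMove]
  linarith

theorem Standing.bregReal_nonneg (S : Standing f h g L) (hσ : MultiBlockStronglyConvex σ h)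
    {x : Space n} (hx : x ∈ interior (effDom h)) (i : Fin N) {z : Block n i}
    (hy : blockMove x i z ∈ effDom h) : 0 ≤ bregReal h (blockMove x i z) x :=
  (mul_nonneg (half_pos (hσ.1 i)).le (sq_nonneg _)).trans (S.le_bregReal hσ hx i hy)

/-- The descent lemma for relatively smooth functions. -/
theorem Standing.le_of_relSmooth (S : Standing f h g L) {x : Space n}
    (hx : x ∈ interior (effDom h)) (i : Fin N) {z : Block n i}
    (hy : blockMove x i z ∈ effDom h) :
    (f (blockMove x i z)).toReal ≤ (f x).toReal + inner ℝ (grad f x i) (z - x i)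
      + L i * bregReal h (blockMove x i z) x := by
  have h1 := (strongConvexOn_zero.2 (S.f_relSmooth.2.2 x (interior_subset hx) i)).gradient_le
    (x := x i) (z := z)
    (by change h (blockMove x i (x i)) < ⊤; rw [blockMove_self]; exact (interior_subset hx : x ∈ effDom h)) hy
    (((S.h_C1.hasFDerivAt_slice isOpen_interior hx i).const_mul (L i)).sub
      (S.f_C1.hasFDerivAt_slice isOpen_interior hx i))
  simp [slice] at h1
  rw [bregReal_blockMove]
  linarith

theorem Standing.descentTest_iff (S : Standing f h g L) {l : ℝ} {x : Space n}
    (hx : x ∈ interior (effDom h)) {i : Fin N} {z : Block n i}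
    (hy : blockMove x i z ∈ effDom h) :
    DescentTest f h l i x z ↔ (f (blockMove x i z)).toReal ≤ (f x).toReal
      + inner ℝ (grad f x i) (z - x i) + l * bregReal h (blockMove x i z) x := by
  have h1 := S.f_C1.1 x hx
  rw [DescentTest, S.breg_eq hx hy, ← EReal.coe_toReal (S.f_relSmooth.2.1 _ hy).ne
    (S.f_proper.1 _), ← EReal.coe_toReal h1.2 h1.1, ← EReal.coe_mul, ← EReal.coe_add,
    ← EReal.coe_add, EReal.coe_le_coe_iff]
  simp

/-- The Bregman distance of a block move is nonnegative, so raising the estimate above `L i` only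
weakens the test. This is what bounds the backtracking estimates. -/
theorem Standing.descentTest_of_le (S : Standing f h g L) (hσ : MultiBlockStronglyConvex σ h)
    {l : ℝ} {x : Space n} (hx : x ∈ interior (effDom h)) {i : Fin N} {z : Block n i}
    (hy : blockMove x i z ∈ effDom h) (hl : L i ≤ l) : DescentTest f h l i x z := by
  rw [S.descentTest_iff hx hy]
  have h1 := mul_le_mul_of_nonneg_right hl (S.bregReal_nonneg hσ hx i hy)
  linarith [S.le_of_relSmooth hx i hy]

/-- The optimality condition for a point of the proximal mapping. -/
theorem Standing.mem_regSubdiff_of_mem_bpalMap (S : Standing f h g L) {γ : ℝ} (hγ : 0 < γ)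
    {i : Fin N} {x : Space n} {z : Block n i} (hz : z ∈ bpalMap f h g γ i x)
    (hy : blockMove x i z ∈ interior (effDom h)) :
    (1 / γ) • (grad h x i - grad h (blockMove x i z) i) - grad f x i ∈ regSubdiff (g i) z := by
  obtain ⟨hx, hy', hg, hmin⟩ := S.bpalMap_spec hγ hz
  refine ⟨hg, fun ε hε => ?_⟩
  have hc := (continuous_blockMove x i).tendsto z
  -- The model is already linear in `f`, so only `h` is expanded at the new point. The tolerance `ε
  -- * γ` becomes `ε` after division by `γ`.
  filter_upwards [hc.eventually (isOpen_interior.mem_nhds hy),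
    hc.eventually (S.h_C1.eventually_abs_le isOpen_interior hy (mul_pos hε hγ))] with u h1 h2
  by_cases hu : g i u < ⊤
  · have h3 := hmin u (interior_subset h1) hu
    rw [← EReal.coe_toReal hg.ne ((S.g_proper i).1 z),
      ← EReal.coe_toReal hu.ne ((S.g_proper i).1 u), ← EReal.coe_add, EReal.coe_le_coe_iff]
    rw [blockMove_sub, inner_blockEmbed, (blockEmbed i).norm_map] at h2
    rw [bregReal_blockMove, bregReal_blockMove] at h3
    have h4 := (abs_le.1 h2).2
    have h5 : (1 / γ) * ((h (blockMove x i u)).toReal - (h (blockMove x i z)).toReal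
        - inner ℝ (grad h (blockMove x i z) i) (u - z)) ≤ ε * ‖u - z‖ := by
      calc _ ≤ (1 / γ) * (ε * γ * ‖u - z‖) :=
            mul_le_mul_of_nonneg_left h4 (one_div_pos.2 hγ).le
        _ = _ := by field_simp
    have h6 : inner ℝ (grad f x i) (u - z) =
        inner ℝ (grad f x i) (u - x i) - inner ℝ (grad f x i) (z - x i) := by
      rw [← inner_sub_right]; congr 1; abel
    have h7 : inner ℝ (grad h x i) (u - z) =
        inner ℝ (grad h x i) (u - x i) - inner ℝ (grad h x i) (z - x i) := by
      rw [← inner_sub_right]; congr 1; abel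
    rw [inner_sub_left, inner_smul_left, inner_sub_left, h6, h7]
    simp only [conj_trivial]
    linarith
  · rw [not_lt_top_iff.1 hu]
    exact le_top

/-- Regular subgradients of the objective from those of the blocks. -/
theorem Standing.mem_regSubdiff_objective (S : Standing f h g L) {x : Space n}
    (hx : x ∈ effDom (objective f g)) {v : Space n}
    (hv : ∀ i, v i - grad f x i ∈ regSubdiff (g i) (x i)) :
    v ∈ regSubdiff (objective f g) x := by
  refine ⟨hx, fun ε hε => ?_⟩
  -- The error is shared by `N` blocks and the expansion of `f`.
  set δ := ε / (N + 1) with hδ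
  have hN : (0 : ℝ) < N + 1 := by positivity
  have hδ0 : 0 < δ := div_pos hε hN
  have h1 := S.f_C1.eventually_abs_le isOpen_interior (S.dom_subset hx) hδ0
  have h2 : ∀ᶠ y in 𝓝 x, ∀ i, g i (x i) +
      ((inner ℝ (v i - grad f x i) (y i - x i) - δ * ‖y i - x i‖ : ℝ) : EReal) ≤ g i (y i) :=
    eventually_all.2 fun i =>
      (show Continuous fun y : Space n => y i by fun_prop).continuousAt.eventually
        ((hv i).2 δ hδ0)
  filter_upwards [h1, h2] with y hy1 hy2
  by_cases hy : y ∈ effDom (objective f g)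
  · have hxg := (S.mem_effDom_objective_iff.1 hx).2
    have hyg := (S.mem_effDom_objective_iff.1 hy).2
    rw [S.objective_eq hx, S.objective_eq hy, ← EReal.coe_add, EReal.coe_le_coe_iff, objReal,
      objReal]
    have h3 : ∀ i, (g i (x i)).toReal + (inner ℝ (v i) (y i - x i)
        - inner ℝ (grad f x i) (y i - x i) - δ * ‖y - x‖) ≤ (g i (y i)).toReal := by
      intro i
      have h4 := hy2 i
      rw [← EReal.coe_toReal (hxg i).ne ((S.g_proper i).1 _),
        ← EReal.coe_toReal (hyg i).ne ((S.g_proper i).1 _), ← EReal.coe_add,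
        EReal.coe_le_coe_iff, inner_sub_left] at h4
      have h5 : ‖y i - x i‖ ≤ ‖y - x‖ := PiLp.norm_apply_le (y - x) i
      nlinarith
    have h6 := Finset.sum_le_sum fun i (_ : i ∈ Finset.univ) => h3 i
    simp only [Finset.sum_add_distrib, Finset.sum_sub_distrib, Finset.sum_const,
      Finset.card_univ, Fintype.card_fin, nsmul_eq_mul] at h6
    have h7 : inner ℝ v (y - x) = ∑ i, inner ℝ (v i) (y i - x i) := PiLp.inner_apply _ _
    have h8 : inner ℝ (grad f x) (y - x) = ∑ i, inner ℝ (grad f x i) (y i - x i) :=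
      PiLp.inner_apply _ _
    have h9 : ε * ‖y - x‖ = N * (δ * ‖y - x‖) + δ * ‖y - x‖ := by
      rw [hδ]; field_simp
    have h10 := (abs_le.1 hy1).1
    rw [h7, h9]
    rw [h8] at h10
    linarith
  · rw [show objective f g y = ⊤ from not_lt_top_iff.1 hy]
    exact le_top

theorem regSubdiff_subset_subdiff {F : Space n → EReal} {x : Space n} :
    regSubdiff F x ⊆ subdiff F x := fun v hv =>
  ⟨hv.1, fun _ => x, fun _ => v, tendsto_const_nhds, tendsto_const_nhds, fun _ => hv,
    tendsto_const_nhds⟩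

end

/-! ### Partial iterates within a cycle -/

theorem norm_le_norm_of_forall_le {u v : Space n} (huv : ∀ j, ‖u j‖ ≤ ‖v j‖) : ‖u‖ ≤ ‖v‖ := by
  refine (sq_le_sq₀ (norm_nonneg _) (norm_nonneg _)).1 ?_
  rw [PiLp.norm_sq_eq_of_L2, PiLp.norm_sq_eq_of_L2]
  exact Finset.sum_le_sum fun j _ => pow_le_pow_left₀ (norm_nonneg _) (huv j) 2

/-- The point of the `k`-th cycle after the update of the first `m` blocks. -/
def mixedIterate (x : ℕ → Space n) (k m : ℕ) : Space n :=
  WithLp.toLp 2 fun j => if (j : ℕ) < m then x (k + 1) j else x k j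

section MixedIterate

variable (x : ℕ → Space n) (k : ℕ)

theorem mixedIterate_apply (m : ℕ) (j : Fin N) :
    mixedIterate x k m j = if (j : ℕ) < m then x (k + 1) j else x k j := rfl

@[simp] theorem mixedIterate_zero : mixedIterate x k 0 = x k := by
  ext1 j
  simp [mixedIterate_apply]

@[simp] theorem mixedIterate_last : mixedIterate x k N = x (k + 1) := by
  ext1 j
  simp [mixedIterate_apply]

theorem mixedIterate_same (i : Fin N) : mixedIterate x k i i = x k i := by
  simp [mixedIterate_apply]

theorem blockMove_mixedIterate (i : Fin N) :
    blockMove (mixedIterate x k i) i (x (k + 1) i) = mixedIterate x k (i + 1) := by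
  ext1 j
  by_cases hj : j = i
  · subst hj; simp [mixedIterate_apply]
  · rw [blockMove_of_ne _ hj, mixedIterate_apply, mixedIterate_apply]
    have h1 : (j : ℕ) ≠ i := fun h => hj (Fin.ext h)
    have h2 : (j : ℕ) < i ↔ (j : ℕ) < i + 1 := by omega
    simp [h2]

theorem norm_mixedIterate_sub_le (m : ℕ) :
    ‖mixedIterate x k m - x k‖ ≤ ‖x (k + 1) - x k‖ := by
  refine norm_le_norm_of_forall_le fun j => ?_
  rw [PiLp.sub_apply, PiLp.sub_apply, mixedIterate_apply]
  split_ifs <;> simp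

theorem norm_sub_mixedIterate_le (m : ℕ) :
    ‖x (k + 1) - mixedIterate x k m‖ ≤ ‖x (k + 1) - x k‖ := by
  refine norm_le_norm_of_forall_le fun j => ?_
  rw [PiLp.sub_apply, PiLp.sub_apply, mixedIterate_apply]
  split_ifs <;> simp

theorem norm_mixedIterate_succ_sub_le (i : Fin N) :
    ‖mixedIterate x k i - mixedIterate x k (i + 1)‖ ≤ ‖x (k + 1) - x k‖ := by
  rw [norm_sub_rev, ← blockMove_mixedIterate, blockMove_sub_self, LinearIsometry.norm_map,
    mixedIterate_same]
  exact PiLp.norm_apply_le (x (k + 1) - x k) i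

end MixedIterate

/-! ### Decrease and relative error of a descent sequence -/

/-- What BPALM and A-BPALM have in common: the steps are proximal steps with stepsizes `τ k i`
bounded away from zero, and pass the descent test with estimates `l k i` uniformly less
than `1 / τ k i`. -/
structure IsDescentSequence (f h : Space n → EReal) (g : (i : Fin N) → Block n i → EReal)
    (c G : ℝ) (τ l : ℕ → Fin N → ℝ) (x : ℕ → Space n) : Prop where
  c_pos : 0 < c
  stepsize_pos : ∀ k i, 0 < τ k i
  stepsize_le : ∀ k i, 1 / τ k i ≤ G
  gap : ∀ k i, l k i + c ≤ 1 / τ k i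
  step : ∀ k i, x (k + 1) i ∈ bpalMap f h g (τ k i) i (mixedIterate x k i)
  test : ∀ k i, DescentTest f h (l k i) i (mixedIterate x k i) (x (k + 1) i)

section

variable {f h : Space n → EReal} {g : (i : Fin N) → Block n i → EReal} {L σ : Fin N → ℝ}
  {c G : ℝ} {τ l : ℕ → Fin N → ℝ} {x : ℕ → Space n}

/-- A minimizer with finite model value has every `g i` finite, and the last block step ends in `dom
h`, where `f` is finite. Nothing is needed of `x 0`. -/
theorem IsDescentSequence.mem_effDom (D : IsDescentSequence f h g c G τ l x)
    (S : Standing f h g L) (k : ℕ) : x (k + 1) ∈ effDom (objective f g) := by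
  rw [S.mem_effDom_objective_iff]
  refine ⟨?_, fun i => (S.bpalMap_spec (D.stepsize_pos k i) (D.step k i)).2.2.1⟩
  -- Without blocks there is no step to use; the space is then a single point, the minimizer.
  rcases Nat.eq_zero_or_pos N with h0 | h0
  · subst h0
    obtain ⟨y, hy⟩ := S.exists_min
    rw [Subsingleton.elim (x (k + 1)) y]
    exact (S.mem_effDom_objective_iff.1 hy.1).1
  · have h1 := (S.bpalMap_spec (D.stepsize_pos k ⟨N - 1, by omega⟩) (D.step k _)).2.1
    rw [blockMove_mixedIterate] at h1
    have h2 : mixedIterate x k (N - 1 + 1) = x (k + 1) := by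
      rw [Nat.sub_add_cancel h0, mixedIterate_last]
    exact S.f_relSmooth.2.1 _ (h2 ▸ h1)

theorem IsDescentSequence.mixedIterate_mem (D : IsDescentSequence f h g c G τ l x)
    (S : Standing f h g L) (k : ℕ) (i : Fin N) :
    mixedIterate x k i ∈ interior (effDom h) :=
  (S.bpalMap_spec (D.stepsize_pos k i) (D.step k i)).1

/-- An intermediate point is the base point of the next block step, hence interior; the last one is
`x^{k+1}`, which lies in `dom φ`. -/
theorem IsDescentSequence.mixedIterate_succ_mem (D : IsDescentSequence f h g c G τ l x)
    (S : Standing f h g L) (k : ℕ) (i : Fin N) :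
    mixedIterate x k (i + 1) ∈ interior (effDom h) := by
  rcases (Nat.succ_le_of_lt i.2).eq_or_lt with h1 | h1
  · rw [show (i : ℕ) + 1 = N from h1, mixedIterate_last]
    exact S.dom_subset (D.mem_effDom S k)
  · exact D.mixedIterate_mem S k ⟨i + 1, h1⟩

/-- Testing minimality at the old block, where the linear and Bregman terms vanish, and adding the
descent test leaves a decrease of `(1 / τ - l) * D_h`, with `1 / τ - l ≥ c`. Strong convexity does
the rest. -/
theorem IsDescentSequence.block_descent (D : IsDescentSequence f h g c G τ l x)
    (S : Standing f h g L) (hσ : MultiBlockStronglyConvex σ h) {a : ℝ}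
    (ha : ∀ i, a ≤ c * (σ i / 2)) {k : ℕ} (hk : x k ∈ effDom (objective f g)) (i : Fin N) :
    objReal f g (mixedIterate x k (i + 1)) + a * ‖x (k + 1) i - x k i‖ ^ 2 ≤
      objReal f g (mixedIterate x k i) := by
  obtain ⟨h1, h2, h3, h4⟩ := S.bpalMap_spec (D.stepsize_pos k i) (D.step k i)
  have h5 := (S.descentTest_iff h1 h2).1 (D.test k i)
  have h6 := h4 (x k i)
    (by rw [← mixedIterate_same x k i, blockMove_self]; exact interior_subset h1)
    ((S.mem_effDom_objective_iff.1 hk).2 i)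
  have h7 := S.le_bregReal hσ h1 i h2
  have h8 : bregReal h (blockMove (mixedIterate x k i) i (x k i)) (mixedIterate x k i) = 0 := by
    rw [← mixedIterate_same x k i, blockMove_self, bregReal]; simp
  rw [h8] at h6
  rw [mixedIterate_same] at h5 h6 h7
  simp only [sub_self, inner_zero_right, mul_zero, zero_add] at h6
  have h9 := mul_le_mul_of_nonneg_right (D.gap k i) (S.bregReal_nonneg hσ h1 i h2)
  have h10 := mul_le_mul_of_nonneg_right (ha i) (sq_nonneg ‖x (k + 1) i - x k i‖)
  have h11 := mul_le_mul_of_nonneg_left h7 D.c_pos.le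
  rw [← blockMove_mixedIterate, objReal, objReal,
    sum_blockMove (fun j u => (g j u).toReal), mixedIterate_same]
  linarith

theorem IsDescentSequence.descent (D : IsDescentSequence f h g c G τ l x)
    (S : Standing f h g L) (hσ : MultiBlockStronglyConvex σ h) {a : ℝ}
    (ha : ∀ i, a ≤ c * (σ i / 2)) {k : ℕ} (hk : x k ∈ effDom (objective f g)) :
    objReal f g (x (k + 1)) + a * ‖x (k + 1) - x k‖ ^ 2 ≤ objReal f g (x k) := by
  have h1 : ∀ m ≤ N, objReal f g (mixedIterate x k m) + a * ‖mixedIterate x k m - x k‖ ^ 2 ≤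
      objReal f g (x k) := by
    intro m
    induction m with
    | zero => simp
    | succ m ih =>
      intro hm
      have h2 := D.block_descent S hσ ha hk ⟨m, hm⟩
      -- Distinct blocks are orthogonal, so the block decreases add up to the full squared step with
      -- the same constant `a`.
      have h3 : ‖mixedIterate x k (m + 1) - x k‖ ^ 2 = ‖mixedIterate x k m - x k‖ ^ 2
          + ‖x (k + 1) ⟨m, hm⟩ - x k ⟨m, hm⟩‖ ^ 2 := by
        have h4 := sum_blockMove (fun j u => ‖u - x k j‖ ^ 2) (mixedIterate x k m) ⟨m, hm⟩
          (x (k + 1) ⟨m, hm⟩)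
        rw [blockMove_mixedIterate x k ⟨m, hm⟩, mixedIterate_same x k ⟨m, hm⟩] at h4
        rw [PiLp.norm_sq_eq_of_L2, PiLp.norm_sq_eq_of_L2]
        simpa using h4
      have h5 := ih (by omega)
      rw [h3]
      simp only at h2
      linarith
  simpa using h1 N le_rfl

/-- The regular subgradient of the objective at `x^{k+1}` given by the optimality conditions. -/
def stepSubgrad (f h : Space n → EReal) (τ : ℕ → Fin N → ℝ) (x : ℕ → Space n) (k : ℕ) :
    Space n :=
  WithLp.toLp 2 fun i => grad f (x (k + 1)) i - grad f (mixedIterate x k i) i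
    + (1 / τ k i) • (grad h (mixedIterate x k i) i - grad h (mixedIterate x k (i + 1)) i)

theorem IsDescentSequence.stepSubgrad_mem (D : IsDescentSequence f h g c G τ l x)
    (S : Standing f h g L) (k : ℕ) :
    stepSubgrad f h τ x k ∈ regSubdiff (objective f g) (x (k + 1)) := by
  refine S.mem_regSubdiff_objective (D.mem_effDom S k) fun i => ?_
  have h1 := S.mem_regSubdiff_of_mem_bpalMap (D.stepsize_pos k i) (D.step k i)
    (by rw [blockMove_mixedIterate]; exact D.mixedIterate_succ_mem S k i)
  rw [blockMove_mixedIterate] at h1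
  convert h1 using 1
  rw [stepSubgrad, PiLp.toLp_apply]
  abel

/-- Both gradient differences in a block join points of the cycle at distance at most `‖x^{k+1} -
x^k‖`. The factor `1 + G` comes from `f` and from the weight `1 / τ` on `h`. -/
theorem norm_stepSubgrad_le {B : Set (Space n)} {K : NNReal} (hG : ∀ k i, 1 / τ k i ≤ G)
    (hτ : ∀ k i, 0 < τ k i) (hf : LipschitzOnWith K (grad f) B)
    (hh : LipschitzOnWith K (grad h) B) {k : ℕ} (hB : ∀ m, mixedIterate x k m ∈ B) :
    ‖stepSubgrad f h τ x k‖ ≤ N * ((1 + G) * K) * ‖x (k + 1) - x k‖ := by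
  have h1 : ∀ i, ‖stepSubgrad f h τ x k i‖ ≤ (1 + G) * K * ‖x (k + 1) - x k‖ := by
    intro i
    have hBx : x (k + 1) ∈ B := by simpa using hB N
    have e1 : ‖grad f (x (k + 1)) i - grad f (mixedIterate x k i) i‖ ≤
        K * ‖x (k + 1) - x k‖ :=
      (PiLp.norm_apply_le (grad f (x (k + 1)) - grad f (mixedIterate x k i)) i).trans
        ((hf.norm_sub_le hBx (hB i)).trans
          (mul_le_mul_of_nonneg_left (norm_sub_mixedIterate_le x k i) K.2))
    have e2 : ‖grad h (mixedIterate x k i) i - grad h (mixedIterate x k (i + 1)) i‖ ≤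
        K * ‖x (k + 1) - x k‖ :=
      (PiLp.norm_apply_le (grad h (mixedIterate x k i) - grad h (mixedIterate x k (i + 1))) i).trans
        ((hh.norm_sub_le (hB i) (hB (i + 1))).trans
          (mul_le_mul_of_nonneg_left (norm_mixedIterate_succ_sub_le x k i) K.2))
    have h0 : 0 ≤ 1 / τ k i := (one_div_pos.2 (hτ k i)).le
    rw [stepSubgrad, PiLp.toLp_apply]
    refine (norm_add_le _ _).trans ?_
    rw [norm_smul, Real.norm_of_nonneg h0]
    have e3 := mul_le_mul (hG k i) e2 (norm_nonneg _) (h0.trans (hG k i))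
    linarith
  refine (norm_le_sum_norm _).trans ((Finset.sum_le_sum fun i _ => h1 i).trans_eq ?_)
  simp only [Finset.sum_const, Finset.card_univ, Fintype.card_fin, nsmul_eq_mul]
  ring

/-- A common Lipschitz constant of two locally Lipschitz maps near a point of an open set. -/
theorem exists_lipschitzOnWith_ball {E F : Type*} [PseudoMetricSpace E] [PseudoMetricSpace F]
    {s : Set E} (hs : IsOpen s) {u v : E → F} (hu : LocallyLipschitzOn s u)
    (hv : LocallyLipschitzOn s v) {x : E} (hx : x ∈ s) :
    ∃ (K : NNReal) (r : ℝ), 0 < r ∧ LipschitzOnWith K u (Metric.ball x r) ∧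
      LipschitzOnWith K v (Metric.ball x r) := by
  obtain ⟨K₁, t₁, ht₁, h₁⟩ := hu hx
  obtain ⟨K₂, t₂, ht₂, h₂⟩ := hv hx
  rw [hs.nhdsWithin_eq hx] at ht₁ ht₂
  obtain ⟨r, hr, hrt⟩ := Metric.mem_nhds_iff.1 (inter_mem ht₁ ht₂)
  exact ⟨max K₁ K₂, r, hr, (h₁.mono fun y hy => (hrt hy).1).weaken (le_max_left _ _),
    (h₂.mono fun y hy => (hrt hy).2).weaken (le_max_right _ _)⟩

end

/-! ### Cluster points and convergence -/

section

variable {f h : Space n → EReal} {g : (i : Fin N) → Block n i → EReal} {L σ : Fin N → ℝ}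
  {c G : ℝ} {τ l : ℕ → Fin N → ℝ} {x : ℕ → Space n}

/-- Finitely many positive numbers have a positive lower bound. -/
theorem exists_pos_forall_le {u : Fin N → ℝ} (hu : ∀ i, 0 < u i) : ∃ a > 0, ∀ i, a ≤ u i := by
  obtain ⟨b, hb, hb0⟩ := ((eventually_all (l := 𝓝[>] (0 : ℝ))).2 fun i =>
    nhdsWithin_le_nhds (eventually_le_nhds (hu i))).and self_mem_nhdsWithin |>.exists
  exact ⟨b, hb0, hb⟩

theorem tendsto_mixedIterate {θ : ℕ → ℕ} {xs : Space n} (hx : Tendsto (x ∘ θ) atTop (𝓝 xs))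
    (hd : Tendsto (fun j => ‖x (θ j + 1) - x (θ j)‖) atTop (𝓝 0)) (m : ℕ) :
    Tendsto (fun j => mixedIterate x (θ j) m) atTop (𝓝 xs) := by
  have h1 : Tendsto (fun j => mixedIterate x (θ j) m - x (θ j)) atTop (𝓝 0) :=
    squeeze_zero_norm (fun j => norm_mixedIterate_sub_le x (θ j) m) hd
  simpa using h1.add hx

/-- The objective is upper semicontinuous along the iterates converging to a cluster point. -/
theorem IsDescentSequence.le_objReal (D : IsDescentSequence f h g c G τ l x)
    (S : Standing f h g L) (hσ : MultiBlockStronglyConvex σ h)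
    (hf : LocallyLipschitzOn (interior (effDom h)) (grad f))
    (hh : LocallyLipschitzOn (interior (effDom h)) (grad h))
    {θ : ℕ → ℕ} {xs : Space n} (hxs : xs ∈ effDom (objective f g))
    (hx : Tendsto (x ∘ θ) atTop (𝓝 xs))
    (hd : Tendsto (fun j => ‖x (θ j + 1) - x (θ j)‖) atTop (𝓝 0)) {Φ : ℝ}
    (hΦ : ∀ k, Φ ≤ objReal f g (x k)) : Φ ≤ objReal f g xs := by
  have hC := S.dom_subset hxs
  have hCn : interior (effDom h) ∈ 𝓝 xs := isOpen_interior.mem_nhds hC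
  have hp : ∀ m, Tendsto (fun j => mixedIterate x (θ j) m) atTop (𝓝 xs) :=
    tendsto_mixedIterate hx hd
  have hx1 : Tendsto (fun j => x (θ j + 1)) atTop (𝓝 xs) := by simpa using hp N
  have hfc : ContinuousAt (grad f) xs := hf.continuousOn.continuousAt hCn
  have hhc : ContinuousAt (grad h) xs := hh.continuousOn.continuousAt hCn
  have hhr : ContinuousAt (fun y => (h y).toReal) xs :=
    (S.h_C1.hasFDerivAt isOpen_interior hC).continuousAt
  have hfr : ContinuousAt (fun y => (f y).toReal) xs :=
    (S.f_C1.hasFDerivAt isOpen_interior hC).continuousAt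
  have hcoord : ∀ i, Continuous fun y : Space n => y i := fun i => by fun_prop
  have hb : ∀ i : Fin N, Tendsto (fun j => blockMove (mixedIterate x (θ j) i) i (xs i)) atTop
      (𝓝 xs) := by
    intro i
    simp only [blockMove_eq]
    have h1 := ((blockEmbed (n := n) i).continuous.tendsto _).comp
      ((((hcoord i).tendsto xs).comp (hp i)).const_sub (xs i))
    simpa using (hp i).add h1
  -- `R` is the excess in the optimality inequality tested at the block `xs i`: the Bregman term of
  -- the step is dropped as nonnegative, that of the competitor gets the weight `G ≥ 1 / τ`. It
  -- vanishes because base and competitor both tend to `xs`.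
  set R : Fin N → ℕ → ℝ := fun i j =>
    inner ℝ (grad f (mixedIterate x (θ j) i) i) (xs i - x (θ j + 1) i)
      + G * bregReal h (blockMove (mixedIterate x (θ j) i) i (xs i)) (mixedIterate x (θ j) i)
    with hR
  have hR0 : ∀ i, Tendsto (R i) atTop (𝓝 0) := by
    intro i
    have h1 : Tendsto (fun j => inner ℝ (grad f (mixedIterate x (θ j) i) i)
        (xs i - x (θ j + 1) i)) atTop (𝓝 (inner ℝ (grad f xs i) (xs i - xs i))) :=
      Tendsto.inner (((hcoord i).tendsto _).comp (hfc.tendsto.comp (hp i)))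
        ((((hcoord i).tendsto xs).comp hx1).const_sub (xs i))
    have h2 : Tendsto (fun j => bregReal h (blockMove (mixedIterate x (θ j) i) i (xs i))
        (mixedIterate x (θ j) i)) atTop
        (𝓝 ((h xs).toReal - (h xs).toReal - inner ℝ (grad h xs) (xs - xs))) :=
      ((hhr.tendsto.comp (hb i)).sub (hhr.tendsto.comp (hp i))).sub
        (Tendsto.inner (hhc.tendsto.comp (hp i)) ((hb i).sub (hp i)))
    simpa using h1.add (h2.const_mul G)
  have hg : ∀ i, ∀ᶠ j in atTop, (g i (x (θ j + 1) i)).toReal ≤ (g i (xs i)).toReal + R i j := by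
    intro i
    filter_upwards [(hb i).eventually hCn] with j hj
    obtain ⟨h1, h2, -, h4⟩ := S.bpalMap_spec (D.stepsize_pos (θ j) i) (D.step (θ j) i)
    have h5 := h4 (xs i) (interior_subset hj) ((S.mem_effDom_objective_iff.1 hxs).2 i)
    have h6 := mul_nonneg (one_div_pos.2 (D.stepsize_pos (θ j) i)).le (S.bregReal_nonneg hσ h1 i h2)
    have h7 := mul_le_mul_of_nonneg_right (D.stepsize_le (θ j) i)
      (S.bregReal_nonneg hσ h1 i (interior_subset hj))
    have h8 : inner ℝ (grad f (mixedIterate x (θ j) i) i) (xs i - x (θ j + 1) i) =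
        inner ℝ (grad f (mixedIterate x (θ j) i) i) (xs i - mixedIterate x (θ j) i i) -
        inner ℝ (grad f (mixedIterate x (θ j) i) i) (x (θ j + 1) i - mixedIterate x (θ j) i i) := by
      rw [← inner_sub_right]; congr 1; abel
    simp only [hR]
    rw [h8]
    linarith
  have hlim : Tendsto (fun j => (f (x (θ j + 1))).toReal + ∑ i, ((g i (xs i)).toReal + R i j))
      atTop (𝓝 ((f xs).toReal + ∑ i, ((g i (xs i)).toReal + 0))) :=
    (hfr.tendsto.comp hx1).add (tendsto_finsetSum _ fun i _ => (hR0 i).const_add _)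
  simp only [add_zero] at hlim
  refine ge_of_tendsto hlim ?_
  filter_upwards [eventually_all.2 hg] with j hj
  exact (hΦ (θ j + 1)).trans (add_le_add_right (Finset.sum_le_sum fun i _ => hj i) _)

/-- The Kurdyka–Łojasiewicz inequality for a given subgradient. -/
theorem one_le_deriv_mul_norm {E : Type*} [NormedAddCommGroup E] [InnerProductSpace ℝ E]
    {F : E → EReal} {x w : E} {D : ℝ} (hw : w ∈ subdiff F x)
    (hD : 1 ≤ ENNReal.ofReal D * Metric.infEDist 0 (subdiff F x)) : 1 ≤ D * ‖w‖ := by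
  have h1 : Metric.infEDist 0 (subdiff F x) ≤ ENNReal.ofReal ‖w‖ := by
    refine (Metric.infEDist_le_edist_of_mem hw).trans_eq ?_
    rw [edist_dist, dist_zero_left]
  have h2 := hD.trans (mul_le_mul_right h1 _)
  rw [← ENNReal.ofReal_mul' (norm_nonneg w), ENNReal.one_le_ofReal] at h2
  exact h2

/-- Global convergence of descent sequences in the domain of a KL objective. -/
theorem IsDescentSequence.globallyConvergent_of_mem (D : IsDescentSequence f h g c G τ l x)
    (S : Standing f h g L) (hσ : MultiBlockStronglyConvex σ h)
    (hf : LocallyLipschitzOn (interior (effDom h)) (grad f))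
    (hh : LocallyLipschitzOn (interior (effDom h)) (grad h))
    (hKL : IsKL (objective f g)) (hmem : ∀ k, x k ∈ effDom (objective f g))
    (hbdd : Bornology.IsBounded (Set.range x)) : GloballyConvergent (objective f g) x := by
  obtain ⟨a, ha0, ha⟩ := exists_pos_forall_le (u := fun i => c * (σ i / 2)) fun i =>
    mul_pos D.c_pos (half_pos (hσ.1 i))
  have hdesc : ∀ k, a * ‖x (k + 1) - x k‖ ^ 2 ≤ objReal f g (x k) - objReal f g (x (k + 1)) :=
    fun k => by linarith [D.descent S hσ ha (hmem k)]
  have hanti : Antitone fun k => objReal f g (x k) := antitone_nat_of_succ_le fun k => by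
    linarith [hdesc k, mul_nonneg ha0.le (sq_nonneg ‖x (k + 1) - x k‖)]
  have hlow : BddBelow (Set.range fun k => objReal f g (x k)) := by
    obtain ⟨y, hy, hymin⟩ := S.exists_min
    refine ⟨objReal f g y, ?_⟩
    rintro _ ⟨k, rfl⟩
    have h1 := hymin (x k)
    rwa [S.objective_eq hy, S.objective_eq (hmem k), EReal.coe_le_coe_iff] at h1
  have hΦ := tendsto_atTop_ciInf hanti hlow
  have hΦle := fun k => ciInf_le hlow k
  set Φ := ⨅ k, objReal f g (x k)
  have hd := tendsto_norm_sub_of_descent ha0 hdesc hΦ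
  obtain ⟨xs, -, θ, hθ, hx⟩ := tendsto_subseq_of_bounded hbdd (Set.mem_range_self (f := x))
  have hθt := hθ.tendsto_atTop
  have hle : ∀ k, objective f g xs ≤ objective f g (x k) := by
    intro k
    by_contra! h1
    have h2 := hx.eventually (S.objective_lsc xs _ h1)
    obtain ⟨j, h3, h4⟩ := (h2.and (hθt.eventually (eventually_ge_atTop k))).exists
    rw [Function.comp_apply, S.objective_eq (hmem k), S.objective_eq (hmem (θ j)),
      gt_iff_lt, EReal.coe_lt_coe_iff] at h3
    exact h3.not_ge (hanti h4)
  -- Hence `xs` is interior to `dom h`: iterates cannot cluster at points where the Lipschitz bounds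
  -- are unavailable.
  have hxs : xs ∈ effDom (objective f g) := (hle 0).trans_lt (hmem 0)
  have hxsΦ : objReal f g xs = Φ := by
    refine le_antisymm (le_ciInf fun k => ?_)
      (D.le_objReal S hσ hf hh hxs hx (hd.comp hθt) hΦle)
    have h1 := hle k
    rwa [S.objective_eq hxs, S.objective_eq (hmem k), EReal.coe_le_coe_iff] at h1
  obtain ⟨K, r, hr, hfK, hhK⟩ :=
    exists_lipschitzOnWith_ball isOpen_interior hf hh (S.dom_subset hxs)
  set M : ℝ := N * ((1 + |G|) * K) with hM
  have hM0 : 0 ≤ M := by positivity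
  have hw : ∀ k, (∀ m, mixedIterate x k m ∈ Metric.ball xs r) →
      ‖stepSubgrad f h τ x k‖ ≤ M * ‖x (k + 1) - x k‖ := fun k hk =>
    norm_stepSubgrad_le (fun k i => (D.stepsize_le k i).trans (le_abs_self G)) D.stepsize_pos
      hfK hhK hk
  -- Radius `r / 3`: a step is then shorter than `2 * r / 3`, and a partial iterate is no farther
  -- from `x k` than `x (k + 1)` is.
  have hmix : ∀ k, x k ∈ Metric.ball xs (r / 3) → x (k + 1) ∈ Metric.ball xs (r / 3) →
      ∀ m, mixedIterate x k m ∈ Metric.ball xs r := by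
    intro k h1 h2 m
    rw [Metric.mem_ball] at h1 h2 ⊢
    have h3 := norm_mixedIterate_sub_le x k m
    rw [← dist_eq_norm, ← dist_eq_norm] at h3
    linarith [dist_triangle (mixedIterate x k m) (x k) xs,
      dist_triangle_right (x (k + 1)) (x k) xs]
  have hx1 : Tendsto (fun j => x (θ j + 1)) atTop (𝓝 xs) := by
    simpa using tendsto_mixedIterate hx (hd.comp hθt) N
  have hcrit : xs ∈ crit (objective f g) := by
    refine ⟨hxs, fun j => x (θ j + 1), fun j => stepSubgrad f h τ x (θ j), hx1, ?_,
      fun j => D.stepSubgrad_mem S (θ j), ?_⟩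
    · have h1 : Tendsto (fun j => objReal f g (x (θ j + 1))) atTop (𝓝 (objReal f g xs)) := by
        rw [hxsΦ]
        exact hΦ.comp ((tendsto_add_atTop_nat 1).comp hθt)
      simp only [S.objective_eq hxs, S.objective_eq (hmem _)]
      exact (continuous_coe_real_ereal.tendsto _).comp h1
    · have h1 : Tendsto (fun j => M * ‖x (θ j + 1) - x (θ j)‖) atTop (𝓝 0) := by
        simpa using (hd.comp hθt).const_mul M
      refine squeeze_zero_norm' ?_ h1
      filter_upwards [hx.eventually (Metric.ball_mem_nhds xs (by linarith : 0 < r / 3)),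
        hx1.eventually (Metric.ball_mem_nhds xs (by linarith : 0 < r / 3))] with j h2 h3
      exact hw _ (hmix _ h2 h3)
  obtain ⟨η, ε, ψ, hη, hε, hψ, hψnn, -, hψC, -, hψKL⟩ := hKL xs ⟨0, hcrit⟩
  have hsum : Summable fun k => ‖x (k + 1) - x k‖ := by
    refine summable_of_kl (s := fun k => objReal f g (x k) - Φ) (r := min (r / 3) ε) hθ hx ha0 hM0
      (lt_min (by linarith) hε) hη (fun k => by linarith [hdesc k])
      (fun k => sub_nonneg.2 (hΦle k)) (by simpa using hΦ.sub_const Φ) hψ hψnn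
      (fun t ht => (hψC.differentiableOn one_ne_zero).differentiableAt (isOpen_Ioo.mem_nhds ht)) ?_
    intro k h1 h2 h3 h4
    have h5 := hψKL (x (k + 1)) (Metric.ball_subset_ball (min_le_right _ _) h2)
    rw [S.objective_eq hxs, S.objective_eq (hmem _), ← EReal.coe_add, EReal.coe_lt_coe_iff,
      EReal.coe_lt_coe_iff, hxsΦ, EReal.toReal_coe, EReal.toReal_coe] at h5
    have h6 := one_le_deriv_mul_norm (regSubdiff_subset_subdiff (D.stepSubgrad_mem S k))
      (h5 (by linarith) (by linarith))
    have h7 := hw k (hmix k (Metric.ball_subset_ball (min_le_left _ _) h1)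
      (Metric.ball_subset_ball (min_le_left _ _) h2))
    -- The sign follows from the KL inequality itself and is needed to enlarge `‖stepSubgrad‖` to
    -- its bound.
    have h8 : 0 ≤ deriv ψ (objReal f g (x (k + 1)) - Φ) := by
      by_contra! h9
      nlinarith [norm_nonneg (stepSubgrad f h τ x k)]
    exact h6.trans (mul_le_mul_of_nonneg_left h7 h8)
  refine ⟨fun i => hsum.of_nonneg_of_le (fun k => norm_nonneg _)
    fun k => PiLp.norm_apply_le (x (k + 1) - x k) i, xs, ?_, hcrit⟩
  refine tendsto_nhds_of_cauchySeq_of_subseq (cauchySeq_of_summable_dist ?_) hθt hx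
  simpa only [dist_eq_norm, norm_sub_rev (x _) (x (Nat.succ _))] using hsum

theorem IsDescentSequence.shift (D : IsDescentSequence f h g c G τ l x) :
    IsDescentSequence f h g c G (fun k => τ (k + 1)) (fun k => l (k + 1))
      (fun k => x (k + 1)) where
  c_pos := D.c_pos
  stepsize_pos k := D.stepsize_pos (k + 1)
  stepsize_le k := D.stepsize_le (k + 1)
  gap k := D.gap (k + 1)
  step k := D.step (k + 1)
  test k := D.test (k + 1)

/-- The starting point may lie outside `dom φ`, but every later iterate is inside. Dropping the
first cycle changes neither summability nor the limit. -/
theorem IsDescentSequence.globallyConvergent (D : IsDescentSequence f h g c G τ l x)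
    (S : Standing f h g L) (hσ : MultiBlockStronglyConvex σ h)
    (hf : LocallyLipschitzOn (interior (effDom h)) (grad f))
    (hh : LocallyLipschitzOn (interior (effDom h)) (grad h))
    (hKL : IsKL (objective f g)) (hbdd : Bornology.IsBounded (Set.range x)) :
    GloballyConvergent (objective f g) x := by
  obtain ⟨h1, xs, h2, h3⟩ := D.shift.globallyConvergent_of_mem S hσ hf hh hKL (D.mem_effDom S)
    (hbdd.subset (Set.range_subset_iff.2 fun k => Set.mem_range_self (k + 1)))
  exact ⟨fun i => (summable_nat_add_iff 1).1 (h1 i), xs, (tendsto_add_atTop_iff_nat 1).1 h2, h3⟩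

/-! ### BPALM and A-BPALM as descent sequences -/

theorem exists_forall_le (u : Fin N → ℝ) : ∃ G, ∀ i, u i ≤ G := by
  obtain ⟨G, hG⟩ := (Set.finite_range u).bddAbove
  exact ⟨G, fun i => hG (Set.mem_range_self i)⟩

theorem IsBPALM.exists_isDescentSequence {γ : Fin N → ℝ} (A : IsBPALM f h g L γ x)
    (S : Standing f h g L) (hσ : MultiBlockStronglyConvex σ h) :
    ∃ c G τ l, IsDescentSequence f h g c G τ l x := by
  obtain ⟨G, hG⟩ := exists_forall_le fun i => 1 / γ i
  obtain ⟨c, hc0, hc⟩ := exists_pos_forall_le (u := fun i => 1 / γ i - L i) fun i =>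
    sub_pos.2 ((lt_div_iff₀ (A.stepsize i).1).2 (by linarith [(A.stepsize i).2]))
  refine ⟨c, G, fun _ => γ, fun _ => L, hc0, fun _ i => (A.stepsize i).1, fun _ => hG,
    fun _ i => by linarith [hc i], A.step, fun k i => ?_⟩
  obtain ⟨h1, h2, -⟩ := S.bpalMap_spec (A.stepsize i).1 (A.step k i)
  exact S.descentTest_of_le hσ h1 h2 le_rfl

theorem IsABPALM.exists_isDescentSequence {ν : ℝ} {Lb γ : ℕ → Fin N → ℝ}
    (A : IsABPALM f h g L ν Lb γ x) (S : Standing f h g L)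
    (hσ : MultiBlockStronglyConvex σ h) : ∃ c G τ l, IsDescentSequence f h g c G τ l x := by
  have hν : 0 < ν := one_pos.trans A.factor
  -- Backtracking multiplies the estimate and divides the stepsize by the same power, so their
  -- product is constant.
  have hinv : ∀ k i, 0 < γ k i ∧ γ k i * Lb k i = γ 0 i * Lb 0 i ∧ Lb 0 i ≤ Lb k i ∧
      Lb k i ≤ ν * L i := by
    intro k i
    have hL := A.initial_estimate i
    induction k with
    | zero => exact ⟨(A.initial_stepsize i).1, rfl, le_rfl, by nlinarith [A.factor]⟩
    | succ k ih =>
      obtain ⟨h1, h2, h3, h4⟩ := ih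
      obtain ⟨p, hp1, hp2, -, -, hp5⟩ := A.step k i
      have hνp : 0 < ν ^ p := pow_pos hν p
      have hνp1 : 1 ≤ ν ^ p := one_le_pow₀ A.factor.le
      refine ⟨hp2 ▸ div_pos h1 hνp, ?_, ?_, ?_⟩
      · rw [hp1, hp2, ← h2]
        field_simp
      · rw [hp1]
        nlinarith
      · rw [hp1]
        rcases p with _ | q
        · simpa using h4
        · obtain ⟨z, hz, hzt⟩ := hp5 q (Nat.lt_succ_self q)
          obtain ⟨e1, e2, -⟩ := S.bpalMap_spec (div_pos h1 (pow_pos hν q)) hz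
          -- The last rejected trial had an estimate below `L i`; the accepted one is `ν` times
          -- larger.
          have h5 : ν ^ q * Lb k i < L i := by
            by_contra! h6
            exact hzt (S.descentTest_of_le hσ e1 e2 h6)
          rw [pow_succ]
          nlinarith
  have hρ : ∀ i, 0 < 1 / (γ 0 i * Lb 0 i) - 1 := by
    intro i
    have h1 := A.initial_stepsize i
    have h2 := (A.initial_estimate i).1
    rw [sub_pos, lt_div_iff₀ (mul_pos h1.1 h2), one_mul]
    exact (lt_div_iff₀ h2).1 h1.2
  have hγ : ∀ k i, 1 / γ k i = 1 / (γ 0 i * Lb 0 i) * Lb k i := by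
    intro k i
    obtain ⟨h1, h2, h3, -⟩ := hinv k i
    have h4 := (A.initial_estimate i).1.trans_le h3
    rw [← h2]
    field_simp
  -- By the invariant product, `1 / γ` is a fixed multiple, greater than 1, of the estimate. The
  -- upper bound `ν * L i` gives `G`, and the lower bound `Lb 0 i` gives the gap `c`.
  obtain ⟨G, hG⟩ := exists_forall_le fun i => 1 / (γ 0 i * Lb 0 i) * (ν * L i)
  obtain ⟨c, hc0, hc⟩ := exists_pos_forall_le
    (u := fun i => (1 / (γ 0 i * Lb 0 i) - 1) * Lb 0 i)
    fun i => mul_pos (hρ i) (A.initial_estimate i).1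
  -- The values accepted in cycle `k` carry the index `k + 1`.
  refine ⟨c, G, fun k => γ (k + 1), fun k => Lb (k + 1), hc0, fun k i => (hinv (k + 1) i).1,
    fun k i => ?_, fun k i => ?_, fun k i => ?_, fun k i => ?_⟩
  · rw [hγ]
    exact (mul_le_mul_of_nonneg_left (hinv (k + 1) i).2.2.2 (by linarith [hρ i])).trans (hG i)
  · rw [hγ]
    have h1 := mul_le_mul_of_nonneg_left (hinv (k + 1) i).2.2.1 (hρ i).le
    linarith [hc i]
  · obtain ⟨p, -, -, h3, -⟩ := A.step k i
    exact h3
  · obtain ⟨p, -, -, -, h4, -⟩ := A.step k i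
    exact h4

end

end BPALM

end

theorem mainTheorem1 {N : ℕ} {n : Fin N → ℕ}
    (f h : BPALM.Space n → EReal) (g : (i : Fin N) → BPALM.Block n i → EReal)
    (L σ : Fin N → ℝ)
    (hstanding : BPALM.Standing f h g L)
    (hstrong : BPALM.MultiBlockStronglyConvex σ h)
    (hLipf : LocallyLipschitzOn (interior (BPALM.effDom h)) (BPALM.grad f))
    (hLiph : LocallyLipschitzOn (interior (BPALM.effDom h)) (BPALM.grad h))
    (hKL : BPALM.IsKL (BPALM.objective f g)) :
    (∀ (γ : Fin N → ℝ) (x : ℕ → BPALM.Space n),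
      BPALM.IsBPALM f h g L γ x → Bornology.IsBounded (Set.range x) →
        BPALM.GloballyConvergent (BPALM.objective f g) x) ∧
    (∀ (ν : ℝ) (Lb γ : ℕ → Fin N → ℝ) (x : ℕ → BPALM.Space n),
      BPALM.IsABPALM f h g L ν Lb γ x → Bornology.IsBounded (Set.range x) →
        BPALM.GloballyConvergent (BPALM.objective f g) x) := by
  refine ⟨fun γ x A hx => ?_, fun ν Lb γ x A hx => ?_⟩
  · obtain ⟨c, G, τ, l, D⟩ := A.exists_isDescentSequence hstanding hstrong
    exact D.globallyConvergent hstanding hstrong hLipf hLiph hKL hx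
  · obtain ⟨c, G, τ, l, D⟩ := A.exists_isDescentSequence hstanding hstrong
    exact D.globallyConvergent hstanding hstrong hLipf hLiph hKL hx
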